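/- Identify $\mathbb{R}^2$ with $\mathbb{C}$ and write $D_R(z)$ for the open disk of radius $R$ centered at $z$. A loop is a $C^2$ map $u:\mathbb{S}^1\to\mathbb{R}^2$ with nowhere vanishing derivative $u'$ (taken with respect to the angle); it is embedded if it is injective. For $\kappa:\mathbb{R}^2\to\mathbb{R}$, a $\kappa$-loop is a loop whose curvature $\langle u'',iu'\rangle/|u'|^3$ equals $\kappa(u)$ at each point. If $A\subset\mathbb{R}^2$ is open with compact closure and $X\in C^1(\mathbb{R}^2)$, we say that $X$ has a stable critical point in $A$ if there is $r>0$ such that every $G\in C^1(\overline A)$ with $\|G-X\|_{C^1(\overline A)}<r$ has a critical point in $A$. Theorem. Let $k>0$ and $K\in C^1(\mathbb{R}^2)$, and put $F_k^K(z)=\int_{D_{1/k}(z)}K(q)\,dq$ for $z\in\mathbb{R}^2$. Assume that $F_k^K$ has a stable critical point in an open set $A\subset\mathbb{R}^2$ with compact closure. Then for every $\varepsilon\in\mathbb{R}$ close enough to $0$ there exists an embedded $(k+\varepsilon K)$-loop $u^\varepsilon:\mathbb{S}^1\to\mathbb{R}^2$. Moreover, these loops can be chosen so that any sequence $\varepsilon_h\to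 0$ has a subsequence $\varepsilon_{h_j}$ such that $u^{\varepsilon_{h_j}}\to\omega_{z_0}$ in $C^2(\mathbb{S}^1,\mathbb{R}^2)$ as $j\to\infty$, where $\omega_{z_0}(x)=z_0+\frac1k x$ parametrizes the circle of radius $1/k$ centered at $z_0$, and $z_0\in\overline A$ is a critical point of $F_k^K$ (so $z_0\in A$ whenever $F_k^K$ has no critical point on $\partial A$). -/

import Mathlib

open Filter Topology MeasureTheory

noncomputable section

namespace PlaneLoops

/-! The plane `ℝ²` is identified with `ℂ` (Euclidean norm, real inner product, Lebesgue measure);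
`i z = (-z₂, z₁)` is multiplication by `Complex.I`. Derivatives are always over `ℝ`. -/

/-- A map `u : 𝕊¹ → ℝ²` read in the angular variable, `θ ↦ u (e^{iθ})`. Its derivative at `θ` is
the derivative `u'(x) = du(x)(ix)` at `x = e^{iθ}`. -/
def angular (u : Circle → ℂ) (θ : ℝ) : ℂ := u (Circle.exp θ)

/-- A loop: a curve `u : 𝕊¹ → ℝ²` of class `C²` with nonzero derivative at each point. -/
def IsLoop (u : Circle → ℂ) : Prop :=
  ContDiff ℝ 2 (angular u) ∧ ∀ θ : ℝ, deriv (angular u) θ ≠ 0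

/-- The curvature `⟨u'', i u'⟩ / |u'|³` of a loop at the point `u (e^{iθ})`. -/
def curvature (u : Circle → ℂ) (θ : ℝ) : ℝ :=
  inner ℝ (iteratedDeriv 2 (angular u) θ) (Complex.I * deriv (angular u) θ)
    / ‖deriv (angular u) θ‖ ^ 3

/-- An embedded `κ`-loop: an injective loop with curvature `κ(u)` at each of its points. -/
def IsEmbeddedLoopOfCurvature (κ : ℂ → ℝ) (u : Circle → ℂ) : Prop :=
  IsLoop u ∧ Function.Injective u ∧ ∀ θ : ℝ, curvature u θ = κ (angular u θ)

/-- Convergence in `C²(𝕊¹, ℝ²)`: the maps and their first two derivatives converge uniformly. -/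
def TendstoC2 (u : ℕ → Circle → ℂ) (v : Circle → ℂ) : Prop :=
  ∀ m : ℕ, m ≤ 2 → TendstoUniformly (fun j => iteratedDeriv m (angular (u j)))
    (iteratedDeriv m (angular v)) atTop

/-- The reference parametrization `ω_z(x) = z + x / k` of the circle of radius `1 / k`
centred at `z`. -/
def refCircle (k : ℝ) (z : ℂ) (x : Circle) : ℂ := z + ((1 / k : ℝ) : ℂ) * (x : ℂ)

/-- The Melnikov function `F(z) = ∫_{D_{1/k}(z)} K(q) dq`. -/
def melnikov (k : ℝ) (K : ℂ → ℝ) (z : ℂ) : ℝ := ∫ q in Metric.ball z (1 / k), K q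

/-- `f` is differentiable at `z` and its gradient vanishes there. -/
def IsCriticalPoint (f : ℂ → ℝ) (z : ℂ) : Prop := HasFDerivAt f (0 : ℂ →L[ℝ] ℝ) z

/-- `G ∈ C¹(Ā)`: `G` is differentiable in the open set `A`, and `G` and its differential on `A`
extend continuously to the closure of `A`. -/
def IsC1Closure (A : Set ℂ) (G : ℂ → ℝ) : Prop :=
  ContinuousOn G (closure A) ∧
    ∃ D : ℂ → (ℂ →L[ℝ] ℝ), ContinuousOn D (closure A) ∧ ∀ z ∈ A, HasFDerivAt G (D z) z

/-- The `C¹(Ā)` norm of a function in `C¹(Ā)`, for `A` open; by continuity the suprema over `A`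
are those over the closure. -/
def c1Norm (A : Set ℂ) (f : ℂ → ℝ) : ENNReal :=
  (⨆ z ∈ A, ‖f z‖ₑ) + ⨆ z ∈ A, ‖fderiv ℝ f z‖ₑ

/-- `X` has a stable critical point in `A`: there is `r > 0` such that every `G ∈ C¹(Ā)` with
`‖G - X‖_{C¹(Ā)} < r` has a critical point in `A`. -/
def HasStableCriticalPoint (X : ℂ → ℝ) (A : Set ℂ) : Prop :=
  ∃ r : ℝ, 0 < r ∧ ∀ G : ℂ → ℝ, IsC1Closure A G →
    c1Norm A (fun z => G z - X z) < ENNReal.ofReal r → ∃ z ∈ A, IsCriticalPoint G z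

end PlaneLoops

end

/-! A loop of positive curvature may be parametrized by the angle `θ` of its outward normal. The
equation then becomes first order, `u' = i e^{iθ} / κ(u)`, and the only obstruction to solving it
with `κ = k + εK` is that `u` must close up. The proof is a Lyapunov–Schmidt reduction for this
equation.

Relax it to `u' = (i e^{iθ} + c) / κ(u)`, where the constant `c` is fixed by requiring zero total
velocity. For small `ε` the function `1/κ` has Lipschitz constant `O(ε)`, so for each prescribed
mean `z` a contraction yields a unique solution `U z`, at distance `O(ε)` from the circle of radius
`1/k` about `z` (`exists_curve_family`). A true loop is a zero of the map `z ↦ c(z)`.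

This map is variational. If `∂₁Q = κ`, the action `∫ (Q(u) u₂' - ⟨e^{is}, u⟩) ds` restricted to the
family `U z` has gradient `-2π i c(z)` (`hasFDerivAt_action`). Expanding `c` in `ε` and using the
gradient theorem on a disk, this gradient equals `ε ∇F + O(ε²)`, with `F` the Melnikov function
(`norm_closingConst_sub_melnikovGrad_le`, `hasFDerivAt_melnikov`). The reduced action divided by `ε`
is therefore `C¹`-close to `F` up to an additive constant, and stability gives a critical point in
`A`.

The resulting curves are embedded because they are convex: along an arc of normal angle at most `π`,
the coordinate in the middle tangent direction is strictly increasing. The equation itself upgrades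
uniform closeness to `C²` convergence. Since `∇F = O(ε)` at the chosen centres, limits of centres
are critical. A cutoff reduces everything to bounded `K` with bounded differential. -/

noncomputable section

namespace PlaneLoops

/-! ### The unit circle and integrals over a period -/

/-- The point `e^{iθ}` of the unit circle, as a complex number. -/
def cis (θ : ℝ) : ℂ := Complex.exp (θ * Complex.I)

lemma norm_cis (θ : ℝ) : ‖cis θ‖ = 1 := Complex.norm_exp_ofReal_mul_I θ

lemma hasDerivAt_cis (θ : ℝ) : HasDerivAt cis (Complex.I * cis θ) θ := by
  have h : HasDerivAt (fun t : ℝ => (t : ℂ) * Complex.I) Complex.I θ := by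
    simpa using (Complex.ofRealCLM.hasDerivAt (x := θ)).mul_const Complex.I
  have h2 := h.cexp
  rwa [mul_comm] at h2

@[fun_prop]
lemma continuous_cis : Continuous cis := by
  unfold cis
  fun_prop

lemma contDiff_cis {n : WithTop ℕ∞} : ContDiff ℝ n cis := by
  have h : ContDiff ℝ n (fun t : ℝ => (t : ℂ)) := Complex.ofRealCLM.contDiff
  exact Complex.contDiff_exp.comp (h.mul contDiff_const)

lemma cis_periodic : Function.Periodic cis (2 * Real.pi) := fun θ => by
  simp only [cis]
  push_cast
  rw [add_mul]
  exact Complex.exp_periodic _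

lemma integral_cis : ∫ s in (0 : ℝ)..2 * Real.pi, cis s = 0 := by
  have h : ∀ s : ℝ, HasDerivAt (fun s => -Complex.I * cis s) (cis s) s := fun s => by
    have := (hasDerivAt_cis s).const_mul (-Complex.I)
    rw [← mul_assoc] at this
    simpa using this
  rw [intervalIntegral.integral_eq_sub_of_hasDerivAt (fun s _ => h s)
    (continuous_cis.intervalIntegrable _ _)]
  have := cis_periodic 0
  rw [zero_add] at this
  simp [this]

lemma norm_integral_two_pi_le {E : Type*} [NormedAddCommGroup E] [NormedSpace ℝ E] {f : ℝ → E}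
    {C : ℝ} (h : ∀ s, ‖f s‖ ≤ C) : ‖∫ s in (0 : ℝ)..2 * Real.pi, f s‖ ≤ 2 * Real.pi * C := by
  have := intervalIntegral.norm_integral_le_of_norm_le_const (a := 0) (b := 2 * Real.pi)
    (f := f) (fun s _ => h s)
  rwa [sub_zero, abs_of_pos Real.two_pi_pos, mul_comm C] at this

/-! ### Closed curves generated by a weight, and their Lipschitz dependence on it -/

/-- A weight: a continuous positive function of the angle with values in `[m, 3m]`. -/
structure IsWeight (m : ℝ) (g : ℝ → ℝ) : Prop where
  pos : 0 < m
  cont : Continuous g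
  periodic : Function.Periodic g (2 * Real.pi)
  lower : ∀ s, m ≤ g s
  upper : ∀ s, g s ≤ 3 * m

/-- The constant `c` for which `(i e^{is} + c) g(s)` has zero integral over a period. -/
def closingConst (g : ℝ → ℝ) : ℂ :=
  -(∫ s in (0 : ℝ)..2 * Real.pi, g s • (Complex.I * cis s)) /
    ((∫ s in (0 : ℝ)..2 * Real.pi, g s : ℝ) : ℂ)

/-- The velocity `(i e^{is} + c) g(s)` of a closed curve. -/
def velocity (g : ℝ → ℝ) (s : ℝ) : ℂ := g s • (Complex.I * cis s + closingConst g)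

/-- The primitive of `velocity g` with zero mean. -/
def centredCurve (g : ℝ → ℝ) (α : ℝ) : ℂ :=
  (∫ s in (0 : ℝ)..α, velocity g s) -
    (2 * Real.pi)⁻¹ • ∫ t in (0 : ℝ)..2 * Real.pi, ∫ s in (0 : ℝ)..t, velocity g s

namespace IsWeight

variable {m : ℝ} {g h : ℝ → ℝ}

lemma integral_lower (hg : IsWeight m g) :
    2 * Real.pi * m ≤ ∫ s in (0 : ℝ)..2 * Real.pi, g s := by
  have := intervalIntegral.integral_mono_on (μ := volume) Real.two_pi_pos.le
    (continuous_const.intervalIntegrable _ _) (hg.cont.intervalIntegrable _ _)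
    (fun x _ => hg.lower x)
  simpa using this

lemma integral_pos (hg : IsWeight m g) : 0 < ∫ s in (0 : ℝ)..2 * Real.pi, g s :=
  lt_of_lt_of_le (mul_pos Real.two_pi_pos hg.pos) hg.integral_lower

lemma norm_closingConst_le (hg : IsWeight m g) : ‖closingConst g‖ ≤ 1 := by
  rw [closingConst, norm_div, norm_neg, Complex.norm_real, Real.norm_eq_abs,
    abs_of_pos hg.integral_pos]
  refine div_le_one_of_le₀ ?_ hg.integral_pos.le
  refine (intervalIntegral.norm_integral_le_integral_norm Real.two_pi_pos.le).trans (le_of_eq ?_)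
  refine intervalIntegral.integral_congr fun s _ => ?_
  simp [norm_cis, abs_of_pos (hg.pos.trans_le (hg.lower s))]

lemma continuous_velocity (hg : IsWeight m g) : Continuous (velocity g) := by
  have := hg.cont
  unfold velocity
  fun_prop

lemma periodic_velocity (hg : IsWeight m g) : Function.Periodic (velocity g) (2 * Real.pi) :=
  fun s => by simp only [velocity, hg.periodic s, cis_periodic s]

lemma integral_velocity (hg : IsWeight m g) :
    ∫ s in (0 : ℝ)..2 * Real.pi, velocity g s = 0 := by
  have hc := hg.cont
  have h1 : IntervalIntegrable (fun s => g s • (Complex.I * cis s)) volume 0 (2 * Real.pi) :=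
    Continuous.intervalIntegrable (by fun_prop) _ _
  have h2 : IntervalIntegrable (fun s => g s • closingConst g) volume 0 (2 * Real.pi) :=
    Continuous.intervalIntegrable (by fun_prop) _ _
  simp only [velocity, smul_add]
  rw [intervalIntegral.integral_add h1 h2, intervalIntegral.integral_smul_const,
    Complex.real_smul, closingConst,
    mul_div_cancel₀ _ (Complex.ofReal_ne_zero.2 hg.integral_pos.ne'), add_neg_cancel]

lemma hasDerivAt_centredCurve (hg : IsWeight m g) (α : ℝ) :
    HasDerivAt (centredCurve g) (velocity g α) α :=
  (intervalIntegral.integral_hasDerivAt_right (hg.continuous_velocity.intervalIntegrable _ _)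
    (hg.continuous_velocity.stronglyMeasurableAtFilter _ _)
    hg.continuous_velocity.continuousAt).sub_const _

lemma continuous_centredCurve (hg : IsWeight m g) : Continuous (centredCurve g) :=
  continuous_iff_continuousAt.2 fun α => (hg.hasDerivAt_centredCurve α).continuousAt

lemma periodic_centredCurve (hg : IsWeight m g) :
    Function.Periodic (centredCurve g) (2 * Real.pi) := fun α => by
  have h1 := hg.periodic_velocity.intervalIntegral_add_eq α 0
  rw [zero_add, hg.integral_velocity] at h1
  have h2 := intervalIntegral.integral_add_adjacent_intervals (μ := volume)
    (hg.continuous_velocity.intervalIntegrable 0 α)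
    (hg.continuous_velocity.intervalIntegrable α (α + 2 * Real.pi))
  simp only [centredCurve]
  rw [← h2, h1, add_zero]

lemma continuous_primitive (hg : IsWeight m g) :
    Continuous fun t : ℝ => ∫ s in (0 : ℝ)..t, velocity g s :=
  intervalIntegral.continuous_primitive
    (fun _ _ => hg.continuous_velocity.intervalIntegrable _ _) 0

lemma integral_centredCurve (hg : IsWeight m g) :
    ∫ s in (0 : ℝ)..2 * Real.pi, centredCurve g s = 0 := by
  simp only [centredCurve]
  rw [intervalIntegral.integral_sub (hg.continuous_primitive.intervalIntegrable _ _)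
    (continuous_const.intervalIntegrable _ _), intervalIntegral.integral_const, sub_zero,
    smul_smul, mul_inv_cancel₀ Real.two_pi_pos.ne', one_smul, sub_self]

/-- With `c = -N/D`, the difference of two quotients is written so that only `‖closingConst g‖ ≤ 1`
and the lower bound `2πm` on the denominator of `h` enter; each of the two numerator terms
contributes at most `2πδ`. -/
lemma norm_closingConst_sub_le (hg : IsWeight m g) (hh : IsWeight m h) {δ : ℝ}
    (hδ : ∀ s, |g s - h s| ≤ δ) : ‖closingConst g - closingConst h‖ ≤ 2 * δ / m := by
  have hgc := hg.cont
  have hhc := hh.cont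
  set N := fun g : ℝ → ℝ => ∫ s in (0 : ℝ)..2 * Real.pi, g s • (Complex.I * cis s) with hN
  set D := fun g : ℝ → ℝ => ∫ s in (0 : ℝ)..2 * Real.pi, g s with hD
  have hDg : 0 < D g := hg.integral_pos
  have hDh : 0 < D h := hh.integral_pos
  have hm := hg.pos
  have hδ0 : 0 ≤ δ := (abs_nonneg _).trans (hδ 0)
  have hNd : ‖N g - N h‖ ≤ 2 * Real.pi * δ := by
    have : N g - N h = ∫ s in (0 : ℝ)..2 * Real.pi, (g s - h s) • (Complex.I * cis s) := by
      simp only [sub_smul]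
      rw [intervalIntegral.integral_sub] <;> exact Continuous.intervalIntegrable (by fun_prop) _ _
    rw [this]
    exact norm_integral_two_pi_le fun s => by
      rw [norm_smul, norm_mul, Complex.norm_I, norm_cis, one_mul, mul_one]
      exact hδ s
  have hDd : |D h - D g| ≤ 2 * Real.pi * δ := by
    have : D h - D g = ∫ s in (0 : ℝ)..2 * Real.pi, (h s - g s) :=
      (intervalIntegral.integral_sub (hhc.intervalIntegrable _ _)
        (hgc.intervalIntegrable _ _)).symm
    rw [this]
    exact norm_integral_two_pi_le (f := fun s => h s - g s) fun s => by
      rw [Real.norm_eq_abs, abs_sub_comm]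
      exact hδ s
  have hcg : ‖closingConst g‖ ≤ 1 := hg.norm_closingConst_le
  have key : closingConst g - closingConst h =
      (closingConst g * ((D h - D g : ℝ) : ℂ) + -(N g - N h)) / (D h : ℂ) := by
    have e1 : (D g : ℂ) ≠ 0 := Complex.ofReal_ne_zero.2 hDg.ne'
    have e2 : (D h : ℂ) ≠ 0 := Complex.ofReal_ne_zero.2 hDh.ne'
    have f1 : closingConst g = -N g / D g := rfl
    have f2 : closingConst h = -N h / D h := rfl
    rw [f1, f2]
    push_cast
    field_simp
    ring
  rw [key, norm_div, Complex.norm_real, Real.norm_eq_abs, abs_of_pos hDh, div_le_div_iff₀ hDh hm]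
  have h1 : ‖closingConst g * ((D h - D g : ℝ) : ℂ) + -(N g - N h)‖ ≤ 2 * (2 * Real.pi * δ) := by
    refine (norm_add_le _ _).trans ?_
    rw [norm_neg, norm_mul, Complex.norm_real, Real.norm_eq_abs]
    have := mul_le_mul hcg hDd (abs_nonneg _) zero_le_one
    linarith
  calc _ ≤ 2 * (2 * Real.pi * δ) * m := by gcongr
    _ = 2 * δ * (2 * Real.pi * m) := by ring
    _ ≤ 2 * δ * D h := by
      gcongr
      exact hh.integral_lower

lemma norm_velocity_sub_le (hg : IsWeight m g) (hh : IsWeight m h) {δ : ℝ}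
    (hδ : ∀ s, |g s - h s| ≤ δ) (s : ℝ) : ‖velocity g s - velocity h s‖ ≤ 8 * δ := by
  have hm := hg.pos
  have hδ0 : 0 ≤ δ := (abs_nonneg _).trans (hδ 0)
  have key : velocity g s - velocity h s = (g s - h s) • (Complex.I * cis s + closingConst g) +
      h s • (closingConst g - closingConst h) := by
    simp only [velocity, Complex.real_smul]
    push_cast
    ring
  rw [key]
  refine (norm_add_le _ _).trans ?_
  rw [norm_smul, norm_smul, Real.norm_eq_abs, Real.norm_eq_abs,
    abs_of_pos (hm.trans_le (hh.lower s))]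
  have h1 : ‖Complex.I * cis s + closingConst g‖ ≤ 2 := by
    refine (norm_add_le _ _).trans ?_
    have := hg.norm_closingConst_le
    simp only [norm_mul, Complex.norm_I, norm_cis]
    linarith
  calc _ ≤ δ * 2 + 3 * m * (2 * δ / m) := by
        gcongr
        · exact hδ s
        · exact hh.upper s
        · exact hg.norm_closingConst_sub_le hh hδ
    _ = 8 * δ := by
        field_simp
        ring

/-- By periodicity it suffices to look at one period. There the primitives differ by at most `2π ·
8δ`, and subtracting the means doubles this bound. -/
lemma norm_centredCurve_sub_le (hg : IsWeight m g) (hh : IsWeight m h) {δ : ℝ}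
    (hδ : ∀ s, |g s - h s| ≤ δ) (α : ℝ) :
    ‖centredCurve g α - centredCurve h α‖ ≤ 32 * Real.pi * δ := by
  have hδ0 : 0 ≤ δ := (abs_nonneg _).trans (hδ 0)
  have hprim : ∀ t ∈ Set.Icc 0 (2 * Real.pi),
      ‖(∫ s in (0 : ℝ)..t, velocity g s) - ∫ s in (0 : ℝ)..t, velocity h s‖ ≤
        16 * Real.pi * δ := fun t ht => by
    rw [← intervalIntegral.integral_sub (hg.continuous_velocity.intervalIntegrable _ _)
      (hh.continuous_velocity.intervalIntegrable _ _)]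
    refine (intervalIntegral.norm_integral_le_of_norm_le_const
      (fun s _ => hg.norm_velocity_sub_le hh hδ s)).trans ?_
    rw [sub_zero, abs_of_nonneg ht.1]
    nlinarith [ht.2]
  obtain ⟨β, hβ, h1⟩ :=
    (hg.periodic_centredCurve.sub hh.periodic_centredCurve).exists_mem_Ico₀ Real.two_pi_pos α
  simp only [Pi.sub_apply] at h1
  rw [h1]
  have key : centredCurve g β - centredCurve h β =
      ((∫ s in (0 : ℝ)..β, velocity g s) - ∫ s in (0 : ℝ)..β, velocity h s) -
      (2 * Real.pi)⁻¹ • ∫ t in (0 : ℝ)..2 * Real.pi,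
        ((∫ s in (0 : ℝ)..t, velocity g s) - ∫ s in (0 : ℝ)..t, velocity h s) := by
    rw [intervalIntegral.integral_sub (hg.continuous_primitive.intervalIntegrable _ _)
      (hh.continuous_primitive.intervalIntegrable _ _), smul_sub, centredCurve, centredCurve]
    abel
  rw [key]
  refine (norm_sub_le _ _).trans ?_
  have h2 : ‖∫ t in (0 : ℝ)..2 * Real.pi,
      ((∫ s in (0 : ℝ)..t, velocity g s) - ∫ s in (0 : ℝ)..t, velocity h s)‖ ≤
      16 * Real.pi * δ * (2 * Real.pi) := by
    refine (intervalIntegral.norm_integral_le_of_norm_le_const (C := 16 * Real.pi * δ)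
      (fun t ht => hprim t ?_)).trans ?_
    · rw [Set.uIoc_of_le Real.two_pi_pos.le] at ht
      exact ⟨ht.1.le, ht.2⟩
    · rw [sub_zero, abs_of_pos Real.two_pi_pos]
  rw [norm_smul, Real.norm_eq_abs, abs_of_pos (inv_pos.2 Real.two_pi_pos)]
  calc _ ≤ 16 * Real.pi * δ + (2 * Real.pi)⁻¹ * (16 * Real.pi * δ * (2 * Real.pi)) := by
        gcongr
        exact hprim β ⟨hβ.1, hβ.2.le⟩
    _ = 32 * Real.pi * δ := by
        field_simp
        ring

end IsWeight

lemma closingConst_const (a : ℝ) : closingConst (fun _ => a) = 0 := by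
  simp only [closingConst, intervalIntegral.integral_smul, intervalIntegral.integral_const_mul,
    integral_cis]
  simp

lemma centredCurve_const (a α : ℝ) : centredCurve (fun _ => a) α = a • cis α := by
  have hv : velocity (fun _ => a) = fun s => a • (Complex.I * cis s) := by
    funext s
    simp [velocity, closingConst_const]
  have hp : ∀ t : ℝ, ∫ s in (0 : ℝ)..t, velocity (fun _ => a) s = a • (cis t - cis 0) :=
    fun t => by
      rw [hv, intervalIntegral.integral_smul, intervalIntegral.integral_eq_sub_of_hasDerivAt
        (fun s _ => hasDerivAt_cis s) (Continuous.intervalIntegrable (by fun_prop) _ _)]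
  simp only [centredCurve, hp]
  rw [intervalIntegral.integral_smul, intervalIntegral.integral_sub
    (continuous_cis.intervalIntegrable _ _) (continuous_const.intervalIntegrable _ _),
    integral_cis, intervalIntegral.integral_const, zero_sub, sub_zero, smul_neg, smul_neg,
    smul_comm a, inv_smul_smul₀ Real.two_pi_pos.ne', smul_sub]
  abel

/-! ### The fixed-point problem with prescribed mean -/

/-- For a Lipschitz weight `γ` with small constant, each `z` is the mean of a closed curve `U z`
whose centred part is generated by the weight `γ` along the curve. -/
theorem exists_curve_family {m ℓ : ℝ} (hm : 0 < m) {γ : ℂ → ℝ} (hlow : ∀ z, m ≤ γ z)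
    (hup : ∀ z, γ z ≤ 3 * m) (hℓ : 0 ≤ ℓ) (hlip : ∀ a b, |γ a - γ b| ≤ ℓ * ‖a - b‖)
    (hsmall : 32 * Real.pi * ℓ ≤ 1 / 2) :
    ∃ U : ℂ → ℝ → ℂ, (∀ z, IsWeight m fun s => γ (U z s)) ∧
      (∀ z α, U z α = z + centredCurve (fun s => γ (U z s)) α) ∧
      ∀ z z' α, ‖U z α - U z' α‖ ≤ 2 * ‖z - z'‖ := by
  have : Fact (0 < 2 * Real.pi) := ⟨Real.two_pi_pos⟩
  have hγ : Continuous γ := by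
    have : LipschitzWith ⟨ℓ, hℓ⟩ γ := LipschitzWith.of_dist_le_mul fun a b => by
      rw [Real.dist_eq, dist_eq_norm]
      exact hlip a b
    exact this.continuous
  have hw : ∀ (z : ℂ) (V : C(AddCircle (2 * Real.pi), ℂ)),
      IsWeight m fun s : ℝ => γ (z + V (s : AddCircle (2 * Real.pi))) := fun z V =>
    { pos := hm
      cont := hγ.comp (continuous_const.add (V.continuous.comp (AddCircle.continuous_mk' _)))
      periodic := fun s => by simp only [AddCircle.coe_add_period]
      lower := fun s => hlow _
      upper := fun s => hup _ }
  -- The unknown is `V = U - z` in the complete space of continuous functions on `ℝ / 2πℤ`.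
  let T : ℂ → C(AddCircle (2 * Real.pi), ℂ) → C(AddCircle (2 * Real.pi), ℂ) := fun z V =>
    ⟨(hw z V).periodic_centredCurve.lift,
      continuous_coinduced_dom.2 (hw z V).continuous_centredCurve⟩
  have hT : ∀ z V (α : ℝ), T z V (α : AddCircle (2 * Real.pi)) =
      centredCurve (fun s : ℝ => γ (z + V (s : AddCircle (2 * Real.pi)))) α :=
    fun z V α => (hw z V).periodic_centredCurve.lift_coe α
  -- One joint estimate in `(z, V)` serves twice: `z = z'` gives the contraction, and at the fixed
  -- points the term `dist V V' / 2` is absorbed, which gives Lipschitz dependence on `z`.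
  have hTd : ∀ z V z' V', dist (T z V) (T z' V') ≤ 1 / 2 * (‖z - z'‖ + dist V V') := by
    intro z V z' V'
    rw [ContinuousMap.dist_le (by positivity)]
    intro x
    induction x using QuotientAddGroup.induction_on with
    | H α =>
      rw [dist_eq_norm]
      refine ((hw z V).norm_centredCurve_sub_le (hw z' V')
        (δ := ℓ * (‖z - z'‖ + dist V V')) (fun s => ?_) α).trans ?_
      · refine (hlip _ _).trans (mul_le_mul_of_nonneg_left ?_ hℓ)
        rw [add_sub_add_comm]
        refine (norm_add_le _ _).trans (add_le_add le_rfl ?_)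
        rw [← dist_eq_norm]
        exact ContinuousMap.dist_apply_le_dist _
      · rw [← mul_assoc]
        gcongr
  have hcontr : ∀ z, ContractingWith (1 / 2) (T z) := fun z =>
    ⟨by rw [← NNReal.coe_lt_coe]; norm_num, LipschitzWith.of_dist_le_mul fun V V' => by
      simpa using hTd z V z V'⟩
  let V : ℂ → C(AddCircle (2 * Real.pi), ℂ) := fun z => ContractingWith.fixedPoint (T z) (hcontr z)
  have hV : ∀ z, T z (V z) = V z := fun z => (hcontr z).fixedPoint_isFixedPt
  have hVd : ∀ z z', dist (V z) (V z') ≤ ‖z - z'‖ := fun z z' => by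
    have := hTd z (V z) z' (V z')
    rw [hV, hV] at this
    linarith
  refine ⟨fun z α => z + V z (α : AddCircle (2 * Real.pi)), fun z => hw z (V z), fun z α => ?_,
    fun z z' α => ?_⟩
  · rw [← hT z (V z) α, hV]
  · rw [add_sub_add_comm, two_mul ‖z - z'‖]
    refine (norm_add_le _ _).trans (add_le_add le_rfl ?_)
    rw [← dist_eq_norm]
    exact (ContinuousMap.dist_apply_le_dist _).trans (hVd z z')

/-! ### Angle curves: regularity, embeddedness, curvature -/

/-- A closed curve whose velocity at angle `θ` is the positive multiple `i e^{iθ} / κ(u)` of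
`i e^{iθ}`. -/
structure IsAngleCurve (κ : ℂ → ℝ) (u : ℝ → ℂ) : Prop where
  periodic : Function.Periodic u (2 * Real.pi)
  pos : ∀ θ, 0 < κ (u θ)
  hasDerivAt : ∀ θ, HasDerivAt u ((κ (u θ))⁻¹ • (Complex.I * cis θ)) θ

/-- The map on the circle whose angular reading is a given periodic curve. -/
def ofAngular (u : ℝ → ℂ) (x : Circle) : ℂ := u (Complex.arg x)

lemma angular_ofAngular {u : ℝ → ℂ} (hu : Function.Periodic u (2 * Real.pi)) :
    angular (ofAngular u) = u := by
  funext θ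
  obtain ⟨n, hn⟩ := Circle.exp_eq_exp.1 (Circle.exp_arg (Circle.exp θ))
  rw [angular, ofAngular, hn]
  exact hu.int_mul n θ

lemma angular_refCircle (k : ℝ) (z : ℂ) :
    angular (refCircle k z) = fun θ => z + (1 / k) • cis θ := by
  funext θ
  simp [angular, refCircle, cis, Circle.coe_exp]

namespace IsAngleCurve

variable {κ : ℂ → ℝ} {u : ℝ → ℂ}

lemma congr {κ' : ℂ → ℝ} (hu : IsAngleCurve κ u) (h : ∀ θ, κ' (u θ) = κ (u θ)) :
    IsAngleCurve κ' u where
  periodic := hu.periodic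
  pos θ := by rw [h]; exact hu.pos θ
  hasDerivAt θ := by rw [h]; exact hu.hasDerivAt θ

lemma deriv_eq (hu : IsAngleCurve κ u) :
    deriv u = fun θ => (κ (u θ))⁻¹ • (Complex.I * cis θ) :=
  funext fun θ => (hu.hasDerivAt θ).deriv

lemma hasDerivAt_deriv (hu : IsAngleCurve κ u) (hκ : ContDiff ℝ 1 κ) (θ : ℝ) :
    HasDerivAt (deriv u) ((κ (u θ))⁻¹ • (-cis θ) +
      (-(fderiv ℝ κ (u θ) ((κ (u θ))⁻¹ • (Complex.I * cis θ))) / κ (u θ) ^ 2) •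
        (Complex.I * cis θ)) θ := by
  rw [hu.deriv_eq]
  have h1 : HasDerivAt (fun θ => κ (u θ))
      (fderiv ℝ κ (u θ) ((κ (u θ))⁻¹ • (Complex.I * cis θ))) θ :=
    ((hκ.differentiable one_ne_zero) (u θ)).hasFDerivAt.comp_hasDerivAt θ (hu.hasDerivAt θ)
  have h2 := (hasDerivAt_cis θ).const_mul Complex.I
  rw [← mul_assoc, Complex.I_mul_I, neg_one_mul] at h2
  exact (h1.inv (hu.pos θ).ne').smul h2

/-- Bootstrap: the right-hand side of the equation for `u'` is as regular as `u`, up to the class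
`C¹` of `κ`. -/
lemma contDiff (hu : IsAngleCurve κ u) (hκ : ContDiff ℝ 1 κ) : ContDiff ℝ 2 u := by
  have hd : Differentiable ℝ u := fun θ => (hu.hasDerivAt θ).differentiableAt
  have hderiv : ∀ n : ℕ, n ≤ 1 → ContDiff ℝ n u → ContDiff ℝ (n + 1) u := fun n hn h => by
    rw [contDiff_succ_iff_deriv]
    refine ⟨hd, by simp, ?_⟩
    rw [hu.deriv_eq]
    exact (((hκ.of_le (by exact_mod_cast hn)).comp h).inv fun θ => (hu.pos θ).ne').smul
      (contDiff_const.mul contDiff_cis)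
  have h0 : ContDiff ℝ ((0 : ℕ) : WithTop ℕ∞) u := contDiff_zero.2 hd.continuous
  have h1 := hderiv 0 (by norm_num) h0
  have h2 := hderiv 1 le_rfl (by simpa using h1)
  simpa [one_add_one_eq_two] using h2

lemma inner_deriv (a θ : ℝ) :
    inner ℝ (cis a) (-Complex.I * ((κ (u θ))⁻¹ • (Complex.I * cis θ))) =
      (κ (u θ))⁻¹ * Real.cos (θ - a) := by
  have h : ∀ t : ℝ, cis t = ⟨Real.cos t, Real.sin t⟩ := fun t =>
    Complex.ext (Complex.exp_ofReal_mul_I_re t) (Complex.exp_ofReal_mul_I_im t)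
  rw [h, h, Real.cos_sub]
  simp [Complex.inner]
  ring

/-- The component of `u` along the tangent direction `i e^{ic}`, with `c` the middle angle, has
derivative `cos(θ - c) / κ(u)`, which is positive in the interior of an arc of angle at most `π`. -/
lemma ne_of_lt (hu : IsAngleCurve κ u) {a b : ℝ} (hab : a < b)
    (hb : b ≤ a + Real.pi) : u a ≠ u b := by
  intro hEq
  set c := (a + b) / 2 with hc
  let f : ℝ → ℝ := fun θ => inner ℝ (cis c) (-Complex.I * u θ)
  have hf : ∀ θ, HasDerivAt f ((κ (u θ))⁻¹ * Real.cos (θ - c)) θ := fun θ => by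
    rw [← inner_deriv]
    have := ((hasDerivAt_const θ (cis c)).inner ℝ ((hu.hasDerivAt θ).const_mul (-Complex.I)))
    rwa [inner_zero_left, add_zero] at this
  have hmono : StrictMonoOn f (Set.Icc a b) := by
    refine strictMonoOn_of_deriv_pos (convex_Icc a b)
      (fun θ _ => (hf θ).continuousAt.continuousWithinAt) fun θ hθ => ?_
    rw [interior_Icc] at hθ
    rw [(hf θ).deriv]
    refine mul_pos (inv_pos.2 (hu.pos θ)) (Real.cos_pos_of_mem_Ioo ⟨?_, ?_⟩) <;>
    · rw [hc]
      linarith [hθ.1, hθ.2]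
  have := hmono (Set.left_mem_Icc.2 hab.le) (Set.right_mem_Icc.2 hab.le) hab
  simp only [f, hEq, lt_irrefl] at this

/-- If the arc from `a` to `b` exceeds `π`, the complementary arc from `b` to `a + 2π` does not. -/
lemma ne_of_lt_of_lt (hu : IsAngleCurve κ u) {a b : ℝ} (hab : a < b)
    (hb : b < a + 2 * Real.pi) : u a ≠ u b := by
  rcases le_total b (a + Real.pi) with h | h
  · exact hu.ne_of_lt hab h
  · rw [← hu.periodic a]
    exact (hu.ne_of_lt hb (by linarith)).symm

lemma isEmbeddedLoop (hu : IsAngleCurve κ u) (hκ : ContDiff ℝ 1 κ) :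
    IsEmbeddedLoopOfCurvature κ (ofAngular u) := by
  rw [IsEmbeddedLoopOfCurvature, IsLoop]
  simp only [curvature, angular_ofAngular hu.periodic]
  refine ⟨⟨hu.contDiff hκ, fun θ => ?_⟩, fun x y hxy => ?_, fun θ => ?_⟩
  · rw [hu.deriv_eq, ← norm_ne_zero_iff]
    simp [norm_cis, (hu.pos θ).ne']
  · have hne : ∀ x y : Circle, Complex.arg x < Complex.arg y → ofAngular u x ≠ ofAngular u y :=
      fun x y h => hu.ne_of_lt_of_lt h (by
        linarith [Complex.neg_pi_lt_arg x, Complex.arg_le_pi y])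
    rcases lt_trichotomy (Complex.arg x) (Complex.arg y) with h | h | h
    · exact absurd hxy (hne x y h)
    · exact Circle.injective_arg h
    · exact absurd hxy.symm (hne y x h)
  · have hp := hu.pos θ
    rw [iteratedDeriv_succ, iteratedDeriv_one, (hu.hasDerivAt_deriv hκ θ).deriv, hu.deriv_eq,
      norm_smul, norm_mul, Complex.norm_I, norm_cis, Real.norm_eq_abs, abs_of_pos (inv_pos.2 hp)]
    have h : ∀ t : ℝ, cis t = ⟨Real.cos t, Real.sin t⟩ := fun t =>
      Complex.ext (Complex.exp_ofReal_mul_I_re t) (Complex.exp_ofReal_mul_I_im t)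
    rw [h]
    -- The derivative of `κ` enters `u''` only in the tangential direction `i e^{iθ}`, orthogonal to
    -- `i u'`, so its value is irrelevant to the curvature.
    generalize -(fderiv ℝ κ (u θ) _) / κ (u θ) ^ 2 = a
    simp [Complex.inner]
    field_simp
    simp only [h]
    linear_combination Real.sin_sq_add_cos_sq θ

end IsAngleCurve

lemma isAngleCurve_refCircle {k : ℝ} (hk : 0 < k) (z : ℂ) :
    IsAngleCurve (fun _ => k) (fun θ => z + (1 / k) • cis θ) where
  periodic θ := by simp only [cis_periodic θ]
  pos _ := hk
  hasDerivAt θ := by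
    simpa using ((hasDerivAt_cis θ).const_smul (1 / k)).const_add z

/-! ### Convergence to circles in `C²` -/

lemma tendstoUniformly_of_norm_sub_le {α E : Type*} [SeminormedAddCommGroup E] {F : ℕ → α → E}
    {f : α → E} {b : ℕ → ℝ} (hb : Tendsto b atTop (𝓝 0))
    (h : ∀ᶠ j in atTop, ∀ x, ‖F j x - f x‖ ≤ b j) : TendstoUniformly F f atTop := by
  rw [Metric.tendstoUniformly_iff]
  intro ε hε
  filter_upwards [h, hb.eventually (gt_mem_nhds hε)] with j hj hj' x
  rw [dist_comm, dist_eq_norm]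
  exact (hj x).trans_lt hj'

lemma abs_inv_sub_inv_le {k κ η : ℝ} (hk : 0 < k) (hκ : k / 2 ≤ κ) (hη : |κ - k| ≤ η) :
    |κ⁻¹ - k⁻¹| ≤ 2 / k ^ 2 * η := by
  have hκ0 : 0 < κ := by linarith
  have h : κ⁻¹ - k⁻¹ = (k - κ) * (κ⁻¹ * k⁻¹) := by
    field_simp
  have h1 : κ⁻¹ ≤ 2 / k := by
    rw [← inv_div]
    exact inv_anti₀ (by linarith) hκ
  rw [h, abs_mul, abs_sub_comm, abs_of_pos (by positivity : 0 < κ⁻¹ * k⁻¹)]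
  calc |κ - k| * (κ⁻¹ * k⁻¹) ≤ η * (2 / k * k⁻¹) := by
        gcongr
        exact (abs_nonneg _).trans hη
    _ = 2 / k ^ 2 * η := by
        field_simp

/-- Angle curves for the curvatures `k + e j * K` that are uniformly close to circles converge in
`C²` as `e j → 0` when the centres converge. -/
theorem tendstoC2_of_isAngleCurve {k M M' C : ℝ} (hk : 0 < k) {K : ℂ → ℝ} (hK : ContDiff ℝ 1 K)
    (hM : ∀ z, |K z| ≤ M) (hM' : ∀ z, ‖fderiv ℝ K z‖ ≤ M') {e : ℕ → ℝ}
    (he : Tendsto e atTop (𝓝 0)) {u : ℕ → ℝ → ℂ} {z : ℕ → ℂ} {z₀ : ℂ}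
    (hz : Tendsto z atTop (𝓝 z₀))
    (hu : ∀ᶠ j in atTop, IsAngleCurve (fun z => k + e j * K z) (u j) ∧
      ∀ θ, ‖u j θ - (z j + (1 / k) • cis θ)‖ ≤ C * |e j|) :
    TendstoC2 (fun j => ofAngular (u j)) (refCircle k z₀) := by
  have hM0 : 0 ≤ M := (abs_nonneg _).trans (hM 0)
  have hM0' : 0 ≤ M' := (norm_nonneg _).trans (hM' 0)
  have he' : Tendsto (fun j => |e j|) atTop (𝓝 0) := by simpa using he.abs
  have hω := isAngleCurve_refCircle hk z₀
  have hsmall : ∀ᶠ j in atTop, M * |e j| ≤ k / 2 := by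
    have : Tendsto (fun j => M * |e j|) atTop (𝓝 0) := by simpa using he'.const_mul M
    filter_upwards [this.eventually (gt_mem_nhds (half_pos hk))] with j hj using hj.le
  have hdiff : ∀ j w, |k + e j * K w - k| ≤ M * |e j| := fun j w => by
    rw [add_sub_cancel_left, abs_mul, mul_comm]
    gcongr
    exact hM w
  have hlow : ∀ j, M * |e j| ≤ k / 2 → ∀ w, k / 2 ≤ k + e j * K w := fun j hj w => by
    linarith [neg_le_of_abs_le (hdiff j w)]
  intro m hm
  rw [angular_refCircle]
  interval_cases m
  · refine tendstoUniformly_of_norm_sub_le (b := fun j => C * |e j| + ‖z j - z₀‖) ?_ ?_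
    · have h1 := (he'.const_mul C).add (tendsto_iff_norm_sub_tendsto_zero.1 hz)
      simpa using h1
    · filter_upwards [hu] with j hj θ
      rw [angular_ofAngular hj.1.periodic, iteratedDeriv_zero, iteratedDeriv_zero]
      have : u j θ - (z₀ + (1 / k) • cis θ) =
          (u j θ - (z j + (1 / k) • cis θ)) + (z j - z₀) := by ring
      rw [this]
      exact (norm_add_le _ _).trans (add_le_add (hj.2 θ) le_rfl)
  · refine tendstoUniformly_of_norm_sub_le (b := fun j => 2 / k ^ 2 * (M * |e j|)) ?_ ?_
    · have h1 := (he'.const_mul M).const_mul (2 / k ^ 2)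
      simpa using h1
    · filter_upwards [hu, hsmall] with j hj hjs θ
      rw [angular_ofAngular hj.1.periodic, iteratedDeriv_one, iteratedDeriv_one, hj.1.deriv_eq,
        hω.deriv_eq, ← sub_smul, norm_smul, norm_mul, Complex.norm_I, norm_cis, one_mul, mul_one]
      exact abs_inv_sub_inv_le hk (hlow j hjs _) (hdiff j _)
  -- The first bound is for the normal part of `u''`, the second for its tangential part, which
  -- carries a factor `e j` from the differential of `k + e j * K`.
  · refine tendstoUniformly_of_norm_sub_le
      (b := fun j => 2 / k ^ 2 * (M * |e j|) + |e j| * M' * (k / 2)⁻¹ / (k / 2) ^ 2) ?_ ?_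
    · have h1 := ((he'.const_mul M).const_mul (2 / k ^ 2)).add
        (((he'.mul_const M').mul_const (k / 2)⁻¹).div_const ((k / 2) ^ 2))
      simpa using h1
    · filter_upwards [hu, hsmall] with j hj hjs θ
      have hκ : ContDiff ℝ 1 fun z => k + e j * K z := contDiff_const.add (contDiff_const.mul hK)
      have hfd : ∀ w, fderiv ℝ (fun z => k + e j * K z) w = e j • fderiv ℝ K w := fun w => by
        rw [fderiv_const_add, fderiv_const_mul ((hK.differentiable one_ne_zero) w)]
      have h2 : ∀ f : ℝ → ℂ, iteratedDeriv 2 f = deriv (deriv f) := fun f => by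
        rw [iteratedDeriv_succ, iteratedDeriv_one]
      rw [angular_ofAngular hj.1.periodic, h2, h2, (hj.1.hasDerivAt_deriv hκ θ).deriv,
        (hω.hasDerivAt_deriv contDiff_const θ).deriv, hfd]
      simp only [fderiv_fun_const, Pi.zero_apply, zero_apply, neg_zero,
        zero_div, zero_smul, add_zero]
      rw [add_sub_right_comm, ← sub_smul]
      have hl := hlow j hjs (u j θ)
      refine (norm_add_le _ _).trans (add_le_add ?_ ?_)
      · rw [norm_smul, norm_neg, norm_cis, mul_one]
        exact abs_inv_sub_inv_le hk hl (hdiff j _)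
      · rw [norm_smul, norm_mul, Complex.norm_I, norm_cis, mul_one, mul_one, norm_div, norm_neg,
          norm_pow, Real.norm_eq_abs (k + _), abs_of_pos (hj.1.pos θ)]
        gcongr
        refine (ContinuousLinearMap.le_opNorm _ _).trans ?_
        rw [norm_smul, norm_smul, norm_mul, Complex.norm_I, norm_cis, mul_one, mul_one, norm_inv,
          Real.norm_eq_abs, Real.norm_eq_abs, abs_of_pos (hj.1.pos θ)]
        have hp := hj.1.pos θ
        gcongr
        exact hM' _

/-! ### The gradient of the Melnikov function -/

lemma setIntegral_ball_eq_polar {g : ℂ → ℝ} (hg : Continuous g) {R : ℝ} (hR : 0 ≤ R) :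
    ∫ q in Metric.ball (0 : ℂ) R, g q =
      ∫ r in (0 : ℝ)..R, ∫ s in (-Real.pi)..Real.pi, r * g (r * cis s) := by
  have hsymm : ∀ p : ℝ × ℝ, Complex.polarCoord.symm p = p.1 * cis p.2 := fun p => by
    simp [cis, Complex.exp_mul_I]
  have hset : (Set.Ioi (0 : ℝ) ×ˢ Set.Ioo (-Real.pi) Real.pi) ∩ (Set.Iio R ×ˢ Set.univ) =
      Set.Ioo 0 R ×ˢ Set.Ioo (-Real.pi) Real.pi := by
    rw [Set.prod_inter_prod, Set.inter_univ, Set.Ioi_inter_Iio]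
  have hcont : Continuous fun p : ℝ × ℝ => p.1 * g (p.1 * cis p.2) := by fun_prop
  rw [← integral_indicator Metric.isOpen_ball.measurableSet,
    ← Complex.integral_comp_polarCoord_symm, polarCoord_target]
  have hcongr : ∀ p ∈ Set.Ioi (0 : ℝ) ×ˢ Set.Ioo (-Real.pi) Real.pi,
      p.1 • (Metric.ball (0 : ℂ) R).indicator g (Complex.polarCoord.symm p) =
        (Set.Iio R ×ˢ Set.univ).indicator (fun p : ℝ × ℝ => p.1 * g (p.1 * cis p.2)) p := by
    intro p hp
    have hp0 : 0 < p.1 := hp.1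
    have hmem : (p.1 : ℂ) * cis p.2 ∈ Metric.ball (0 : ℂ) R ↔
        p ∈ Set.Iio R ×ˢ (Set.univ : Set ℝ) := by
      simp [norm_cis, abs_of_pos hp0]
    rw [hsymm]
    by_cases h : p ∈ Set.Iio R ×ˢ (Set.univ : Set ℝ)
    · rw [Set.indicator_of_mem h, Set.indicator_of_mem (hmem.2 h), smul_eq_mul]
    · rw [Set.indicator_of_notMem h, Set.indicator_of_notMem (mt hmem.1 h), smul_zero]
  rw [setIntegral_congr_fun (measurableSet_Ioi.prod measurableSet_Ioo) hcongr,
    setIntegral_indicator (measurableSet_Iio.prod MeasurableSet.univ), hset,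
    Measure.volume_eq_prod, setIntegral_prod]
  · rw [intervalIntegral.integral_of_le hR, integral_Ioc_eq_integral_Ioo]
    refine setIntegral_congr_fun measurableSet_Ioo fun r _ => ?_
    simp only
    rw [intervalIntegral.integral_of_le (by linarith [Real.pi_pos]), integral_Ioc_eq_integral_Ioo]
  · exact (hcont.continuousOn.integrableOn_compact (isCompact_Icc.prod isCompact_Icc)).mono_set
      (Set.prod_mono Set.Ioo_subset_Icc_self Set.Ioo_subset_Icc_self)

lemma inner_cis_decomposition (s : ℝ) (w : ℂ) :
    w = inner ℝ (cis s) w • cis s + inner ℝ (Complex.I * cis s) w • (Complex.I * cis s) := by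
  have h : cis s = ⟨Real.cos s, Real.sin s⟩ :=
    Complex.ext (Complex.exp_ofReal_mul_I_re s) (Complex.exp_ofReal_mul_I_im s)
  rw [h]
  generalize hc : Real.cos s = c
  generalize hs : Real.sin s = d
  have hcd : d ^ 2 + c ^ 2 = 1 := by
    rw [← hc, ← hs]
    exact Real.sin_sq_add_cos_sq s
  apply Complex.ext <;> simp [Complex.inner]
  · linear_combination -w.re * hcd
  · linear_combination -w.im * hcd

/-- The gradient theorem on a disk. -/
theorem setIntegral_ball_fderiv {f : ℂ → ℝ} (hf : ContDiff ℝ 1 f) {R : ℝ} (hR : 0 ≤ R) (w : ℂ) :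
    ∫ q in Metric.ball (0 : ℂ) R, fderiv ℝ f q w =
      R * ∫ s in (0 : ℝ)..2 * Real.pi, f (R * cis s) * inner ℝ (cis s) w := by
  have hDf : Continuous (fderiv ℝ f) := hf.continuous_fderiv one_ne_zero
  have hfc : Continuous f := hf.continuous
  have hd : ∀ q, HasFDerivAt f (fderiv ℝ f q) q := fun q =>
    (hf.differentiable one_ne_zero q).hasFDerivAt
  rw [setIntegral_ball_eq_polar (by fun_prop) hR]
  let φ : ℝ → ℝ := fun s => inner ℝ (cis s) w
  let ψ : ℝ → ℝ := fun s => inner ℝ (Complex.I * cis s) w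
  have hφ : ∀ s, HasDerivAt φ (ψ s) s := fun s => by
    simpa [φ, ψ] using (hasDerivAt_cis s).inner ℝ (hasDerivAt_const s w)
  have hψ : ∀ s, HasDerivAt ψ (-φ s) s := fun s => by
    have h := ((hasDerivAt_cis s).const_mul Complex.I).inner ℝ (hasDerivAt_const s w)
    rw [← mul_assoc, Complex.I_mul_I, neg_one_mul, inner_neg_left, inner_zero_right,
      zero_add] at h
    exact h
  have hsnd : ∀ p : ℝ × ℝ, HasFDerivAt (fun p : ℝ × ℝ => p.2) (ContinuousLinearMap.snd ℝ ℝ ℝ) p :=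
    fun p => hasFDerivAt_snd
  have hφ2 : ∀ p : ℝ × ℝ, HasFDerivAt (fun p : ℝ × ℝ => φ p.2)
      (ψ p.2 • ContinuousLinearMap.snd ℝ ℝ ℝ) p := fun p => (hφ p.2).comp_hasFDerivAt p (hsnd p)
  have hψ2 : ∀ p : ℝ × ℝ, HasFDerivAt (fun p : ℝ × ℝ => ψ p.2)
      (-φ p.2 • ContinuousLinearMap.snd ℝ ℝ ℝ) p := fun p => (hψ p.2).comp_hasFDerivAt p (hsnd p)
  have hcis : ∀ p : ℝ × ℝ, HasFDerivAt (fun p : ℝ × ℝ => cis p.2)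
      ((ContinuousLinearMap.toSpanSingleton ℝ (Complex.I * cis p.2)).comp
        (ContinuousLinearMap.snd ℝ ℝ ℝ)) p := fun p =>
    (hasDerivAt_cis p.2).hasFDerivAt.comp p (hsnd p)
  have hfst : ∀ p : ℝ × ℝ, HasFDerivAt (fun p : ℝ × ℝ => p.1) (ContinuousLinearMap.fst ℝ ℝ ℝ) p :=
    fun p => hasFDerivAt_fst
  have hfe : ∀ p : ℝ × ℝ, HasFDerivAt (fun p : ℝ × ℝ => f (p.1 • cis p.2)) _ p := fun p =>
    (hd _).comp p ((hfst p).smul (hcis p))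
  -- In polar coordinates the integrand `r Df(w)` is the divergence `∂_r (r f φ) + ∂_s (f ψ)`,
  -- because `ψ' = -φ` cancels the undifferentiated term `f φ`. On the boundary of the rectangle, `r
  -- = 0` contributes nothing and the sides `s = ±π` cancel by periodicity, leaving `r = R`.
  have hP : ∀ p : ℝ × ℝ, ∃ P' : ℝ × ℝ →L[ℝ] ℝ,
      HasFDerivAt (fun p : ℝ × ℝ => p.1 * (f (p.1 • cis p.2) * φ p.2)) P' p ∧
      P' (1, 0) = p.1 * (φ p.2 * fderiv ℝ f (p.1 • cis p.2) (cis p.2)) +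
        f (p.1 • cis p.2) * φ p.2 := fun p =>
    ⟨_, (hfst p).mul ((hfe p).mul (hφ2 p)), by simp⟩
  have hQ : ∀ p : ℝ × ℝ, ∃ Q' : ℝ × ℝ →L[ℝ] ℝ,
      HasFDerivAt (fun p : ℝ × ℝ => f (p.1 • cis p.2) * ψ p.2) Q' p ∧
      Q' (0, 1) = f (p.1 • cis p.2) * -φ p.2 +
        ψ p.2 * (p.1 * fderiv ℝ f (p.1 • cis p.2) (Complex.I * cis p.2)) := fun p =>
    ⟨_, (hfe p).mul (hψ2 p), by simp⟩
  choose P' hP hP1 using hP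
  choose Q' hQ hQ1 using hQ
  have hsum : ∀ p : ℝ × ℝ,
      P' p (1, 0) + Q' p (0, 1) = p.1 * fderiv ℝ f (p.1 * cis p.2) w := fun p => by
    have hw : fderiv ℝ f (p.1 * cis p.2) w = φ p.2 * fderiv ℝ f (p.1 * cis p.2) (cis p.2) +
        ψ p.2 * fderiv ℝ f (p.1 * cis p.2) (Complex.I * cis p.2) := by
      conv_lhs => rw [inner_cis_decomposition p.2 w, map_add, map_smul, map_smul]
      rfl
    rw [hP1, hQ1, hw, Complex.real_smul]
    ring
  have hdiv := integral2_divergence_prod_of_hasFDerivAt _ _ _ _ 0 (-Real.pi) R Real.pi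
    (fun p _ => (hP p).continuousAt.continuousWithinAt)
    (fun p _ => (hQ p).continuousAt.continuousWithinAt)
    (fun p _ => hP p) (fun p _ => hQ p) (by
      simp only [hsum]
      exact (Continuous.continuousOn (by fun_prop)).integrableOn_compact
        (isCompact_uIcc.prod isCompact_uIcc))
  simp only [hsum] at hdiv
  have hpi : ∀ {E : Type} (g : ℝ → E), Function.Periodic g (2 * Real.pi) →
      g Real.pi = g (-Real.pi) := fun g hg => by
    rw [← hg (-Real.pi)]
    congr 1
    ring
  have hper : Function.Periodic (fun s => f (R * cis s) * φ s) (2 * Real.pi) := fun s => by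
    simp only [φ, cis_periodic s]
  have hshift := hper.intervalIntegral_add_eq (-Real.pi) 0
  rw [zero_add, show -Real.pi + 2 * Real.pi = Real.pi by ring] at hshift
  have hψpi : ψ Real.pi = ψ (-Real.pi) := hpi ψ fun s => by simp only [ψ, cis_periodic s]
  rw [hdiv, hψpi, hpi cis cis_periodic, ← hshift, intervalIntegral.integral_const_mul]
  simp only [Complex.real_smul]
  simp

/-- The gradient of the Melnikov function, as an integral over the boundary circle. -/
def melnikovGrad (k : ℝ) (K : ℂ → ℝ) (z : ℂ) : ℂ :=
  (1 / k) • ∫ s in (0 : ℝ)..2 * Real.pi, K (z + (1 / k) • cis s) • cis s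

lemma inner_intervalIntegral {a b : ℝ} {f : ℝ → ℂ} (hf : Continuous f) (w : ℂ) :
    inner ℝ (∫ s in a..b, f s) w = ∫ s in a..b, inner ℝ (f s) w := by
  have := (innerSL ℝ w).intervalIntegral_comp_comm (μ := volume) (hf.intervalIntegrable a b)
  simp only [innerSL_apply_apply] at this
  rw [real_inner_comm, ← this]
  simp only [real_inner_comm]

theorem hasFDerivAt_melnikov {k : ℝ} (hk : 0 < k) {K : ℂ → ℝ} (hK : ContDiff ℝ 1 K) {M' : ℝ}
    (hM' : ∀ z, ‖fderiv ℝ K z‖ ≤ M') (z : ℂ) :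
    HasFDerivAt (melnikov k K) (innerSL ℝ (melnikovGrad k K z)) z := by
  have hDK : Continuous (fderiv ℝ K) := hK.continuous_fderiv one_ne_zero
  have hKc : Continuous K := hK.continuous
  -- Translating the disk to the origin moves `z` into the integrand, where differentiation under
  -- the integral applies.
  have htr : melnikov k K = fun z => ∫ q in Metric.ball (0 : ℂ) (1 / k), K (z + q) := by
    funext z
    rw [melnikov, ← (measurePreserving_add_left volume z).setIntegral_preimage_emb
      (measurableEmbedding_addLeft z)]
    congr 2
    ext q
    simp [dist_eq_norm]
  have hfin : IsFiniteMeasure (volume.restrict (Metric.ball (0 : ℂ) (1 / k))) :=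
    ⟨by rw [Measure.restrict_apply_univ]; exact measure_ball_lt_top⟩
  have hint : ∀ {E : Type} [NormedAddCommGroup E] {g : ℂ → E}, Continuous g →
      IntegrableOn g (Metric.ball (0 : ℂ) (1 / k)) := fun hg =>
    (hg.continuousOn.integrableOn_compact (isCompact_closedBall 0 (1 / k))).mono_set
      Metric.ball_subset_closedBall
  have hder : HasFDerivAt (melnikov k K)
      (∫ q in Metric.ball (0 : ℂ) (1 / k), fderiv ℝ K (z + q)) z := by
    rw [htr]
    refine hasFDerivAt_integral_of_dominated_of_fderiv_le (F' := fun z q => fderiv ℝ K (z + q))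
      (bound := fun _ => M') univ_mem (Eventually.of_forall fun y =>
        (hKc.comp (by fun_prop : Continuous fun q => y + q)).aestronglyMeasurable)
      (hint (by fun_prop)) (Continuous.aestronglyMeasurable (by fun_prop))
      (Eventually.of_forall fun q y _ => hM' _) (integrable_const _)
      (Eventually.of_forall fun q y _ => ?_)
    exact (hK.differentiable one_ne_zero (y + q)).hasFDerivAt.comp y
      ((hasFDerivAt_id y).add_const q)
  convert hder using 1
  ext1 w
  have hi : Integrable (fun q => fderiv ℝ K (z + q))
      (volume.restrict (Metric.ball (0 : ℂ) (1 / k))) := hint (by fun_prop)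
  rw [ContinuousLinearMap.integral_apply hi]
  have hshift : ∀ q, fderiv ℝ K (z + q) w = fderiv ℝ (fun q => K (z + q)) q w := fun q => by
    rw [fderiv_comp_add_left]
  simp only [hshift]
  have hKz : ContDiff ℝ 1 fun q => K (z + q) := hK.comp (contDiff_const.add contDiff_id)
  rw [setIntegral_ball_fderiv hKz (by positivity),
    innerSL_apply_apply, melnikovGrad, inner_smul_left, inner_intervalIntegral (by fun_prop)]
  simp only [Complex.real_smul, Complex.ofReal_div, Complex.ofReal_one, conj_trivial]
  congr 1
  refine intervalIntegral.integral_congr fun s _ => ?_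
  rw [← Complex.real_smul, inner_smul_left, conj_trivial]

/-! ### The action functional and its first variation -/

/-- The map `x + iy ↦ t x + iy`. -/
def contractRe (t : ℝ) : ℂ →L[ℝ] ℂ :=
  t • Complex.reCLM.smulRight (1 : ℂ) + Complex.imCLM.smulRight Complex.I

lemma contractRe_apply (t : ℝ) (z : ℂ) : contractRe t z = t * z.re + z.im * Complex.I := by
  simp [contractRe]

@[fun_prop]
lemma continuous_contractRe : Continuous contractRe := by
  unfold contractRe
  fun_prop

/-- Every `C¹` function of the plane is the first partial derivative of a `C¹` function. -/
theorem exists_contDiff_fderiv_one_eq {κ : ℂ → ℝ} (hκ : ContDiff ℝ 1 κ) :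
    ∃ Q : ℂ → ℝ, ContDiff ℝ 1 Q ∧ ∀ z, fderiv ℝ Q z 1 = κ z := by
  have hD : Continuous (fderiv ℝ κ) := hκ.continuous_fderiv one_ne_zero
  have hc : Continuous κ := hκ.continuous
  let J' : ℂ → ℝ → (ℂ →L[ℝ] ℝ) := fun z t => (fderiv ℝ κ (contractRe t z)).comp (contractRe t)
  have hJ'c : Continuous (Function.uncurry J') := by
    have h1 : Continuous fun p : ℂ × ℝ => contractRe p.2 := by fun_prop
    have h2 : Continuous fun p : ℂ × ℝ => contractRe p.2 p.1 := by fun_prop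
    exact (hD.comp h2).clm_comp h1
  have hJ : ∀ z, HasFDerivAt (fun z => ∫ t in (0 : ℝ)..1, κ (contractRe t z))
      (∫ t in (0 : ℝ)..1, J' z t) z := fun z => by
    obtain ⟨C, hC⟩ := ((isCompact_closedBall z 1).prod
      (isCompact_Icc (a := (0 : ℝ)) (b := 1))).exists_bound_of_continuousOn hJ'c.continuousOn
    refine intervalIntegral.hasFDerivAt_integral_of_dominated_of_fderiv_le
      (bound := fun _ => C) (Metric.closedBall_mem_nhds z one_pos)
      (Eventually.of_forall fun y => Continuous.aestronglyMeasurable (by fun_prop))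
      (Continuous.intervalIntegrable (by fun_prop) _ _)
      (Continuous.uncurry_left z hJ'c).aestronglyMeasurable
      (Eventually.of_forall fun t ht y hy => hC (y, t) ⟨hy, ?_⟩)
      (continuous_const.intervalIntegrable _ _)
      (Eventually.of_forall fun t _ y _ => ?_)
    · rw [Set.uIoc_of_le zero_le_one] at ht
      exact ⟨ht.1.le, ht.2⟩
    · exact (hκ.differentiable one_ne_zero _).hasFDerivAt.comp y (contractRe t).hasFDerivAt
  -- This is `∫_0^x κ(ξ, y) dξ` after the substitution `ξ = t x`, which fixes the interval of
  -- integration.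
  have hQ : ∀ z, HasFDerivAt (fun z : ℂ => z.re * ∫ t in (0 : ℝ)..1, κ (contractRe t z))
      (z.re • (∫ t in (0 : ℝ)..1, J' z t) +
        (∫ t in (0 : ℝ)..1, κ (contractRe t z)) • Complex.reCLM) z := fun z =>
    Complex.reCLM.hasFDerivAt.mul (hJ z)
  refine ⟨fun z : ℂ => z.re * ∫ t in (0 : ℝ)..1, κ (contractRe t z),
    contDiff_one_iff_hasFDerivAt.2 ⟨_, ?_, hQ⟩, fun z => ?_⟩
  · have h1 : Continuous fun z => ∫ t in (0 : ℝ)..1, J' z t :=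
      intervalIntegral.continuous_parametric_intervalIntegral_of_continuous' hJ'c 0 1
    have h2 : Continuous fun z => ∫ t in (0 : ℝ)..1, κ (contractRe t z) :=
      intervalIntegral.continuous_parametric_intervalIntegral_of_continuous'
        (by unfold Function.uncurry; fun_prop) 0 1
    exact (Complex.continuous_re.smul h1).add (h2.smul continuous_const)
  · have hJz : Continuous (J' z) := Continuous.uncurry_left z hJ'c
    have hline : ∀ t : ℝ, HasDerivAt (fun t => contractRe t z) (z.re : ℂ) t := fun t => by
      simp only [contractRe_apply]
      simpa using ((Complex.ofRealCLM.hasDerivAt (x := t)).mul_const (z.re : ℂ)).add_const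
        (z.im * Complex.I)
    -- Integrating the derivative of `t κ(tx, y)` over `[0, 1]` recovers `κ(x, y)` as `∂₁Q`.
    have hprim : ∀ t : ℝ, HasDerivAt (fun t => t * κ (contractRe t z))
        (κ (contractRe t z) + z.re * J' z t 1) t := fun t => by
      have h := (hasDerivAt_id t).mul ((hκ.differentiable one_ne_zero
        (contractRe t z)).hasFDerivAt.comp_hasDerivAt t (hline t))
      refine h.congr_deriv ?_
      have e1 : contractRe t 1 = t • (1 : ℂ) := by simp [contractRe_apply]
      have e2 : (z.re : ℂ) = z.re • (1 : ℂ) := by simp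
      rw [e2]
      simp only [J', ContinuousLinearMap.comp_apply, e1, map_smul]
      simp
      ring
    have hint := intervalIntegral.integral_eq_sub_of_hasDerivAt (a := 0) (b := 1)
      (fun t _ => hprim t) (Continuous.intervalIntegrable (by fun_prop) _ _)
    rw [intervalIntegral.integral_add (Continuous.intervalIntegrable (by fun_prop) _ _)
      (Continuous.intervalIntegrable (by fun_prop) _ _),
      intervalIntegral.integral_const_mul] at hint
    have h1 : contractRe 1 z = z := by simp [contractRe_apply, Complex.re_add_im]
    rw [h1, one_mul, zero_mul, sub_zero] at hint
    rw [(hQ z).fderiv, ← hint, add_apply, smul_apply,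
      smul_apply,
      ContinuousLinearMap.intervalIntegral_apply (hJz.intervalIntegrable _ _)]
    simp
    ring

/-- First-order Taylor expansion of a `C¹` function, uniform on a compact set. -/
lemma exists_uniform_taylor {Q : ℂ → ℝ} (hQ : ContDiff ℝ 1 Q) {S : Set ℂ} (hS : IsCompact S)
    {η : ℝ} (hη : 0 < η) : ∃ δ > 0, ∀ a ∈ S, ∀ b, ‖b - a‖ < δ →
      |Q b - Q a - fderiv ℝ Q a (b - a)| ≤ η * ‖b - a‖ := by
  have hD : Continuous (fderiv ℝ Q) := hQ.continuous_fderiv one_ne_zero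
  obtain ⟨δ, hδ, h⟩ := Metric.mem_uniformity_dist.1 (hS.uniformContinuousAt_of_continuousAt
    (fderiv ℝ Q) (fun a _ => hD.continuousAt) (Metric.dist_mem_uniformity hη))
  refine ⟨δ, hδ, fun a ha b hb => ?_⟩
  refine (convex_ball a δ).norm_image_sub_le_of_norm_hasFDerivWithin_le' (f := Q)
    (f' := fderiv ℝ Q) (fun x _ => (hQ.differentiable one_ne_zero x).hasFDerivAt.hasFDerivWithinAt)
    (fun x hx => ?_) (Metric.mem_ball_self hδ) (by rwa [Metric.mem_ball, dist_eq_norm])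
  rw [← dist_eq_norm, dist_comm]
  exact (h (by rwa [dist_comm] : dist a x < δ) ha).le

/-- The action `∫ (Q(u) u₂' - ⟨e^{is}, u⟩) ds` of a closed curve; with `∂₁Q = κ` its critical points
are the angle curves of `κ`. -/
def action (Q : ℂ → ℝ) (u : ℝ → ℂ) : ℝ :=
  ∫ s in (0 : ℝ)..2 * Real.pi, (Q (u s) * (deriv u s).im - inner ℝ (cis s) (u s))

/-- The pointwise Euler–Lagrange identity, with `L` the differential of `Q`, `p` the velocity and
`h` the variation. The term `L p * h.im` is what integrating `Q(u) h₂'` by parts produces, and the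
constant `c` survives only through its pairing with `h`. -/
lemma action_integrand_identity (L : ℂ →L[ℝ] ℝ) {p e c h : ℂ} (hc : L 1 • p = Complex.I * e + c) :
    L h * p.im - L p * h.im - inner ℝ e h + inner ℝ (Complex.I * c) h = 0 := by
  have hL : ∀ x : ℂ, L x = x.re * L 1 + x.im * L Complex.I := fun x => by
    conv_lhs => rw [← Complex.re_add_im x]
    rw [show (x.re : ℂ) + x.im * Complex.I = x.re • (1 : ℂ) + x.im • Complex.I by simp,
      map_add, map_smul, map_smul]
    rfl
  have h1 := congrArg Complex.re hc
  have h2 := congrArg Complex.im hc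
  simp at h1 h2
  rw [hL h, hL p]
  simp [Complex.inner]
  linear_combination (-h.im) * h1 + h.re * h2

/-- First variation of the action along a Lipschitz family of closed curves with prescribed mean
satisfying the curvature equation up to a constant. -/
theorem hasFDerivAt_action {κ Q : ℂ → ℝ} (hQ : ContDiff ℝ 1 Q) (hQκ : ∀ z, fderiv ℝ Q z 1 = κ z)
    {U U' : ℂ → ℝ → ℂ} (hU : ∀ z α, HasDerivAt (U z) (U' z α) α) (hU' : ∀ z, Continuous (U' z))
    (hper : ∀ z, Function.Periodic (U z) (2 * Real.pi))
    (hmean : ∀ z, ∫ s in (0 : ℝ)..2 * Real.pi, U z s = (2 * Real.pi) • z) {C : ℝ} (hC : 0 ≤ C)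
    {z c : ℂ} (hlip : ∀ y α, ‖U y α - U z α‖ ≤ C * ‖y - z‖)
    (hlip' : ∀ y α, ‖U' y α - U' z α‖ ≤ C * ‖y - z‖)
    (heq : ∀ α, κ (U z α) • U' z α = Complex.I * cis α + c) :
    HasFDerivAt (fun y => action Q (U y)) (innerSL ℝ (-(2 * Real.pi) • (Complex.I * c))) z := by
  have hDc : Continuous (fderiv ℝ Q) := hQ.continuous_fderiv one_ne_zero
  have hQc : Continuous Q := hQ.continuous
  have hUc : ∀ y, Continuous (U y) := fun y =>
    continuous_iff_continuousAt.2 fun α => (hU y α).continuousAt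
  have hder : ∀ y, deriv (U y) = U' y := fun y => funext fun α => (hU y α).deriv
  -- The error after removing the first variation: a Taylor remainder of `Q` times the new velocity,
  -- plus a product of two increments. The former is `o(‖y - z‖)`, the latter `O(‖y - z‖²)`.
  let E : ℂ → ℝ → ℝ := fun y s =>
    (Q (U y s) - Q (U z s) - fderiv ℝ Q (U z s) (U y s - U z s)) * (U' y s).im +
      fderiv ℝ Q (U z s) (U y s - U z s) * (U' y s - U' z s).im
  have hexact : ∀ y, ∫ s in (0 : ℝ)..2 * Real.pi, (Q (U z s) * (U' y s - U' z s).im +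
      fderiv ℝ Q (U z s) (U' z s) * (U y s - U z s).im) = 0 := fun y => by
    have hd : ∀ s, HasDerivAt (fun s => Q (U z s) * (U y s - U z s).im)
        (Q (U z s) * (U' y s - U' z s).im +
          fderiv ℝ Q (U z s) (U' z s) * (U y s - U z s).im) s := fun s => by
      have h1 := (hQ.differentiable one_ne_zero (U z s)).hasFDerivAt.comp_hasDerivAt s (hU z s)
      have h2 := Complex.imCLM.hasFDerivAt.comp_hasDerivAt s ((hU y s).sub (hU z s))
      refine (h1.mul h2).congr_deriv ?_
      simp
      ring
    have h1 := hUc y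
    have h2 := hUc z
    have h3 := hU' y
    have h4 := hU' z
    rw [intervalIntegral.integral_eq_sub_of_hasDerivAt (fun s _ => hd s)
      (Continuous.intervalIntegrable (by fun_prop) _ _)]
    have e1 := hper y 0
    have e2 := hper z 0
    rw [zero_add] at e1 e2
    rw [e1, e2, sub_self]
  have hEint : ∀ y, action Q (U y) - action Q (U z) -
      innerSL ℝ (-(2 * Real.pi) • (Complex.I * c)) (y - z) =
        ∫ s in (0 : ℝ)..2 * Real.pi, E y s := fun y => by
    have h1 := hUc y
    have h2 := hUc z
    have h3 := hU' y
    have h4 := hU' z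
    -- Since the curves have means `y` and `z`, the increment integrates to `2π (y - z)`; this turns
    -- the constant `c` into a gradient in the centre.
    have hlin : innerSL ℝ (-(2 * Real.pi) • (Complex.I * c)) (y - z) =
        -∫ s in (0 : ℝ)..2 * Real.pi, inner ℝ (Complex.I * c) (U y s - U z s) := by
      have hi := inner_intervalIntegral (a := 0) (b := 2 * Real.pi)
        (f := fun s => U y s - U z s) (by fun_prop) (Complex.I * c)
      rw [intervalIntegral.integral_sub (h1.intervalIntegrable _ _) (h2.intervalIntegrable _ _),
        hmean, hmean, ← smul_sub, inner_smul_left] at hi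
      simp only [real_inner_comm _ (Complex.I * c)] at hi ⊢
      rw [innerSL_apply_apply, inner_smul_left, ← hi, real_inner_comm]
      simp
    rw [hlin, sub_neg_eq_add, action, action, hder, hder, ← intervalIntegral.integral_sub,
      ← intervalIntegral.integral_add]
    refine (sub_zero _).symm.trans ((congrArg₂ (· - ·) rfl (hexact y).symm).trans ?_)
    rw [← intervalIntegral.integral_sub]
    rotate_left
    all_goals try exact Continuous.intervalIntegrable (by fun_prop) _ _
    refine intervalIntegral.integral_congr fun s _ => ?_
    have hid := action_integrand_identity (fderiv ℝ Q (U z s)) (p := U' z s) (e := cis s)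
      (c := c) (h := U y s - U z s) (by rw [hQκ]; exact heq s)
    simp only [E, inner_sub_right, Complex.sub_im] at hid ⊢
    linear_combination hid
  obtain ⟨D, hD⟩ := (isCompact_Icc (a := (0 : ℝ)) (b := 2 * Real.pi)).exists_bound_of_continuousOn
    (hDc.comp (hUc z)).continuousOn
  obtain ⟨B, hB⟩ := (isCompact_Icc (a := (0 : ℝ)) (b := 2 * Real.pi)).exists_bound_of_continuousOn
    (hU' z).continuousOn
  have h0mem : (0 : ℝ) ∈ Set.Icc 0 (2 * Real.pi) := ⟨le_rfl, Real.two_pi_pos.le⟩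
  have hD0 : 0 ≤ D := (norm_nonneg _).trans (hD 0 h0mem)
  have hB0 : 0 ≤ B := (norm_nonneg _).trans (hB 0 h0mem)
  rw [hasFDerivAt_iff_isLittleO, Asymptotics.isLittleO_iff]
  intro η hη
  have hpi := Real.pi_pos
  -- `η₁` and the last entry of `ρ` are chosen so that each part of the error integrates to at most
  -- `(η / 2) d`; the `+ 1` avoids a zero denominator.
  set η₁ := η / (4 * Real.pi * (C * (B + C) + 1)) with hη₁
  have hη₁0 : 0 < η₁ := by positivity
  obtain ⟨δ, hδ, htay⟩ := exists_uniform_taylor hQ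
    ((isCompact_Icc (a := (0 : ℝ)) (b := 2 * Real.pi)).image (hUc z)) hη₁0
  set ρ := min (min 1 (δ / (C + 1))) (η / (4 * Real.pi * (D * C ^ 2 + 1))) with hρ
  have hρ0 : 0 < ρ := by positivity
  filter_upwards [Metric.ball_mem_nhds z hρ0] with y hy
  rw [Metric.mem_ball, dist_eq_norm] at hy
  set d := ‖y - z‖ with hd
  have hd0 : 0 ≤ d := norm_nonneg _
  have hd1 : d ≤ 1 := hy.le.trans ((min_le_left _ _).trans (min_le_left _ _))
  have hdδ : C * d < δ := by
    have h1 : d < δ / (C + 1) := hy.trans_le ((min_le_left _ _).trans (min_le_right _ _))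
    rw [lt_div_iff₀ (by positivity)] at h1
    nlinarith
  have hdη : d ≤ η / (4 * Real.pi * (D * C ^ 2 + 1)) := hy.le.trans (min_le_right _ _)
  have hE : ∀ s ∈ Set.Icc 0 (2 * Real.pi),
      ‖E y s‖ ≤ η₁ * (C * d) * (B + C) + D * (C * d) * (C * d) := fun s hs => by
    refine (norm_add_le _ _).trans (add_le_add ?_ ?_)
    · rw [norm_mul]
      have h1 := htay _ (Set.mem_image_of_mem _ hs) (U y s) ((hlip y s).trans_lt hdδ)
      have h2 : ‖(U' y s).im‖ ≤ B + C := by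
        refine (Complex.abs_im_le_norm _).trans ?_
        have : U' y s = U' z s + (U' y s - U' z s) := by ring
        rw [this]
        refine (norm_add_le _ _).trans (add_le_add (hB s hs) ((hlip' y s).trans ?_))
        exact mul_le_of_le_one_right hC hd1
      refine mul_le_mul (h1.trans ?_) h2 (norm_nonneg _) (by positivity)
      gcongr
      exact hlip y s
    · rw [norm_mul]
      refine mul_le_mul ?_ ((Complex.abs_im_le_norm _).trans (hlip' y s)) (norm_nonneg _)
        (by positivity)
      exact (ContinuousLinearMap.le_opNorm _ _).trans
        (mul_le_mul (hD s hs) (hlip y s) (norm_nonneg _) hD0)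
  rw [hEint]
  refine (intervalIntegral.norm_integral_le_of_norm_le_const fun s hs => hE s ?_).trans ?_
  · rw [Set.uIoc_of_le Real.two_pi_pos.le] at hs
    exact ⟨hs.1.le, hs.2⟩
  · rw [sub_zero, abs_of_pos Real.two_pi_pos]
    have e1 : η₁ * (C * (B + C)) * (2 * Real.pi) ≤ η / 2 := by
      have : η₁ * (C * (B + C) + 1) * (2 * Real.pi) = η / 2 := by
        rw [hη₁]
        field_simp
        ring
      nlinarith
    have e2 : d * (D * C ^ 2) * (2 * Real.pi) ≤ η / 2 := by
      rw [le_div_iff₀ (by positivity)] at hdη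
      nlinarith
    calc _ = (η₁ * (C * (B + C)) * (2 * Real.pi) + d * (D * C ^ 2) * (2 * Real.pi)) * d := by ring
      _ ≤ (η / 2 + η / 2) * d := by gcongr
      _ = η * d := by ring

/-! ### Expansion of the closing constant and the finite-dimensional reduction -/

lemma abs_inv_sub_inv_le_of_lower {k a b : ℝ} (hk : 0 < k) (ha : k / 2 ≤ a) (hb : k / 2 ≤ b) :
    |a⁻¹ - b⁻¹| ≤ 4 / k ^ 2 * |a - b| := by
  have ha0 : 0 < a := by linarith
  have hb0 : 0 < b := by linarith
  have h : a⁻¹ - b⁻¹ = (b - a) * (a⁻¹ * b⁻¹) := by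
    field_simp
  have h1 : ∀ x, k / 2 ≤ x → x⁻¹ ≤ 2 / k := fun x hx => by
    rw [← inv_div]
    exact inv_anti₀ (by linarith) hx
  rw [h, abs_mul, abs_sub_comm, abs_of_pos (by positivity : 0 < a⁻¹ * b⁻¹)]
  calc |a - b| * (a⁻¹ * b⁻¹) ≤ |a - b| * (2 / k * (2 / k)) := by
        gcongr
        · exact h1 a ha
        · exact h1 b hb
    _ = 4 / k ^ 2 * |a - b| := by
        field_simp
        ring

/-- The closing constant of a weight close to `1 / k` along a curve close to a circle is, to first
order, a rotated multiple of the gradient of the Melnikov function. -/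
lemma norm_closingConst_sub_melnikovGrad_le {k M L C ε : ℝ} (hk : 0 < k) {K : ℂ → ℝ}
    (hKc : Continuous K) (hM : ∀ z, |K z| ≤ M) (hL : ∀ a b, |K a - K b| ≤ L * ‖a - b‖)
    (hL0 : 0 ≤ L) (hC0 : 0 ≤ C) (hε : |ε| * M ≤ k / 2) {u : ℝ → ℂ} (hu : Continuous u) {z : ℂ}
    (hC : ∀ α, ‖u α - (z + (1 / k) • cis α)‖ ≤ C * |ε|)
    (hw : IsWeight (2 / (3 * k)) fun s => (k + ε * K (u s))⁻¹) :
    ‖-(2 * Real.pi) • (Complex.I * closingConst fun s => (k + ε * K (u s))⁻¹) -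
        ε • melnikovGrad k K z‖ ≤
      2 * Real.pi * (L * C * (2 / k) + 2 * M ^ 2 / k ^ 2 + 12 * M ^ 2 / k ^ 2) * ε ^ 2 := by
  have hM0 : 0 ≤ M := (abs_nonneg _).trans (hM 0)
  set g : ℝ → ℝ := fun s => (k + ε * K (u s))⁻¹ with hg
  have hgc : Continuous g := hw.cont
  set c := closingConst g with hc
  have hεK : ∀ w, |ε * K w| ≤ |ε| * M := fun w => by
    rw [abs_mul]
    gcongr
    exact hM w
  have hlow : ∀ s, k / 2 ≤ k + ε * K (u s) := fun s => by
    linarith [neg_le_of_abs_le (hεK (u s))]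
  have hgk : ∀ s, |g s - k⁻¹| ≤ 2 / k ^ 2 * (|ε| * M) := fun s =>
    abs_inv_sub_inv_le hk (hlow s) (by rw [add_sub_cancel_left]; exact hεK _)
  have hgid : ∀ s, 1 - k * g s = ε * (K (u s) * g s) := fun s => by
    have : k + ε * K (u s) ≠ 0 := by linarith [hlow s]
    simp only [hg]
    field_simp
    ring
  have hgup : ∀ s, g s ≤ 2 / k := fun s => (hw.upper s).trans (le_of_eq (by field_simp))
  have hg0 : ∀ s, 0 ≤ g s := fun s => hw.pos.le.trans (hw.lower s)
  set D := ∫ s in (0 : ℝ)..2 * Real.pi, g s with hD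
  have hcD : c * D = -∫ s in (0 : ℝ)..2 * Real.pi, g s • (Complex.I * cis s) := by
    rw [hc, closingConst, div_mul_cancel₀ _ (Complex.ofReal_ne_zero.2 hw.integral_pos.ne')]
  have hcnorm : ‖c‖ ≤ 6 * M / k * |ε| := by
    have hconst : IsWeight (2 / (3 * k)) fun _ => k⁻¹ :=
      { pos := hw.pos
        cont := continuous_const
        periodic := fun _ => rfl
        lower := fun _ => by
          rw [div_le_iff₀ (by positivity)]
          field_simp
          norm_num
        upper := fun _ => by
          field_simp
          norm_num }
    have := hw.norm_closingConst_sub_le hconst hgk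
    rw [closingConst_const, sub_zero] at this
    refine this.trans (le_of_eq ?_)
    field_simp
    ring
  have hDk : |2 * Real.pi - k * D| ≤ 2 * Real.pi * (|ε| * (2 * M / k)) := by
    have h : 2 * Real.pi - k * D = ∫ s in (0 : ℝ)..2 * Real.pi, ε * (K (u s) * g s) := by
      simp only [← hgid]
      rw [intervalIntegral.integral_sub (continuous_const.intervalIntegrable _ _)
        (Continuous.intervalIntegrable (by fun_prop) _ _), intervalIntegral.integral_const_mul]
      simp [hD]
    rw [h, ← Real.norm_eq_abs]
    refine norm_integral_two_pi_le fun s => ?_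
    rw [Real.norm_eq_abs, abs_mul, abs_mul, abs_of_nonneg (hg0 s)]
    have := hg0 s
    calc _ ≤ |ε| * (M * (2 / k)) := by
          gcongr
          · exact hM _
          · exact hgup s
      _ = |ε| * (2 * M / k) := by ring
  -- As `∫ e^{is} ds = 0`, the weight `k g` may be replaced by `k g - 1 = -ε K(u) g`, which exhibits
  -- the factor `ε` exactly.
  have hmain : -Complex.I * c * (k * D) =
      ε • ∫ s in (0 : ℝ)..2 * Real.pi, (K (u s) * g s) • cis s := by
    have h1 : ∫ s in (0 : ℝ)..2 * Real.pi, g s • (Complex.I * cis s) =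
        Complex.I * ∫ s in (0 : ℝ)..2 * Real.pi, g s • cis s := by
      rw [← intervalIntegral.integral_const_mul]
      simp only [mul_smul_comm]
    have h2 : (k : ℂ) * ∫ s in (0 : ℝ)..2 * Real.pi, g s • cis s =
        -(ε • ∫ s in (0 : ℝ)..2 * Real.pi, (K (u s) * g s) • cis s) := by
      have h3 : ∀ s, k • g s • cis s = cis s - ε • (K (u s) * g s) • cis s := fun s => by
        rw [smul_smul, smul_smul, ← hgid, sub_smul, one_smul, sub_sub_cancel]
      rw [← Complex.real_smul, ← intervalIntegral.integral_smul, ← intervalIntegral.integral_smul]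
      simp only [h3]
      rw [intervalIntegral.integral_sub (continuous_cis.intervalIntegrable _ _)
        (Continuous.intervalIntegrable (by fun_prop) _ _), integral_cis, zero_sub]
    calc -Complex.I * c * (k * D) = -Complex.I * k * (c * D) := by ring
      _ = Complex.I * Complex.I * (k * ∫ s in (0 : ℝ)..2 * Real.pi, g s • cis s) := by
        rw [hcD, h1]
        ring
      _ = _ := by
        rw [h2, Complex.I_mul_I]
        ring
  -- Two errors remain: replacing `K(u) g` by its value on the circle with `g = 1/k`, and replacing
  -- `k D` by `2π`. Each deviation is `O(ε)` and is multiplied by a further `ε` or by `c = O(ε)`.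
  have hdecomp : -(2 * Real.pi) • (Complex.I * c) - ε • melnikovGrad k K z =
      ε • (∫ s in (0 : ℝ)..2 * Real.pi,
        (K (u s) * g s - K (z + (1 / k) • cis s) * k⁻¹) • cis s) +
      (-Complex.I * c) * ((2 * Real.pi - k * D : ℝ) : ℂ) := by
    have h1 : ∫ s in (0 : ℝ)..2 * Real.pi,
        (K (u s) * g s - K (z + (1 / k) • cis s) * k⁻¹) • cis s =
        (∫ s in (0 : ℝ)..2 * Real.pi, (K (u s) * g s) • cis s) - melnikovGrad k K z := by
      simp only [sub_smul, melnikovGrad]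
      rw [← intervalIntegral.integral_smul, intervalIntegral.integral_sub
        (Continuous.intervalIntegrable (by fun_prop) _ _)
        (Continuous.intervalIntegrable (by fun_prop) _ _)]
      congr 1
      refine intervalIntegral.integral_congr fun s _ => ?_
      simp only [smul_smul]
      congr 1
      ring
    rw [h1, smul_sub, ← hmain, Complex.real_smul]
    push_cast
    ring
  rw [hdecomp]
  refine (norm_add_le _ _).trans ?_
  have hfirst : ‖∫ s in (0 : ℝ)..2 * Real.pi,
      (K (u s) * g s - K (z + (1 / k) • cis s) * k⁻¹) • cis s‖ ≤
      2 * Real.pi * (L * (C * |ε|) * (2 / k) + M * (2 / k ^ 2 * (|ε| * M))) := by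
    refine norm_integral_two_pi_le fun s => ?_
    rw [norm_smul, norm_cis, mul_one]
    have : K (u s) * g s - K (z + (1 / k) • cis s) * k⁻¹ =
        (K (u s) - K (z + (1 / k) • cis s)) * g s + K (z + (1 / k) • cis s) * (g s - k⁻¹) := by
      ring
    rw [this]
    have hgs := hg0 s
    refine (norm_add_le _ _).trans ?_
    rw [norm_mul, norm_mul, Real.norm_eq_abs, Real.norm_eq_abs, Real.norm_eq_abs,
      Real.norm_eq_abs, abs_of_nonneg (hg0 s)]
    gcongr
    · exact (hL _ _).trans (mul_le_mul_of_nonneg_left (hC s) hL0)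
    · exact hgup s
    · exact hM _
    · exact hgk s
  rw [norm_smul, norm_mul, norm_mul, norm_neg, Complex.norm_I, one_mul, Complex.norm_real,
    Real.norm_eq_abs, Real.norm_eq_abs]
  calc _ ≤ |ε| * (2 * Real.pi * (L * (C * |ε|) * (2 / k) + M * (2 / k ^ 2 * (|ε| * M)))) +
        6 * M / k * |ε| * (2 * Real.pi * (|ε| * (2 * M / k))) := by
        gcongr
    _ = 2 * Real.pi * (L * C * (2 / k) + 2 * M ^ 2 / k ^ 2 + 12 * M ^ 2 / k ^ 2) * |ε| ^ 2 := by
        field_simp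
        ring
    _ = _ := by rw [sq_abs]

/-- Finite-dimensional reduction: for small `ε` there is a `C¹` function of the plane whose
critical points give closed curves of curvature `k + ε K` near circles, and whose gradient is
`ε` times that of the Melnikov function up to `O(ε²)`. -/
theorem exists_reduction {k M L : ℝ} (hk : 0 < k) {K : ℂ → ℝ} (hK : ContDiff ℝ 1 K)
    (hM : ∀ z, |K z| ≤ M) (hL : ∀ z, ‖fderiv ℝ K z‖ ≤ L) :
    ∃ ε₁ > 0, ∃ C ≥ 0, ∀ ε : ℝ, |ε| < ε₁ →
      ∃ (U : ℂ → ℝ → ℂ) (v : ℂ → ℂ) (a : ℂ → ℝ), Continuous v ∧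
        (∀ z, HasFDerivAt a (innerSL ℝ (v z)) z) ∧
        (∀ z, v z = 0 → IsAngleCurve (fun z => k + ε * K z) (U z)) ∧
        (∀ z α, ‖U z α - (z + (1 / k) • cis α)‖ ≤ C * |ε|) ∧
        ∀ z, ‖v z - ε • melnikovGrad k K z‖ ≤ C * ε ^ 2 := by
  have hM0 : 0 ≤ M := (abs_nonneg _).trans (hM 0)
  have hL0 : 0 ≤ L := (norm_nonneg _).trans (hL 0)
  have hpi := Real.pi_pos
  have hKlip : ∀ a b, |K a - K b| ≤ L * ‖a - b‖ := fun a b =>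
    convex_univ.norm_image_sub_le_of_norm_hasFDerivWithin_le
      (fun x _ => (hK.differentiable one_ne_zero x).hasFDerivAt.hasFDerivWithinAt)
      (fun x _ => hL x) (Set.mem_univ b) (Set.mem_univ a)
  set C₁ := 32 * Real.pi * (2 / k ^ 2 * M) with hC₁
  have hC₁0 : 0 ≤ C₁ := by positivity
  set C₂ := 2 * Real.pi * (L * C₁ * (2 / k) + 2 * M ^ 2 / k ^ 2 + 12 * M ^ 2 / k ^ 2) with hC₂
  have hC₂0 : 0 ≤ C₂ := by positivity
  -- The first threshold keeps `k + ε K` in `[k/2, 3k/2]`, whence the ratio `3` in the bounds on the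
  -- weight; the second makes the fixed-point map a contraction.
  refine ⟨min (k / (2 * (M + 1))) (k ^ 2 / (256 * Real.pi * (L + 1))), by positivity,
    C₁ + C₂, by positivity, fun ε hε => ?_⟩
  have hε1 : |ε| * M ≤ k / 2 := by
    have := hε.trans_le (min_le_left _ _)
    rw [lt_div_iff₀ (by positivity)] at this
    nlinarith [abs_nonneg ε]
  have hε2 : 32 * Real.pi * (4 / k ^ 2 * (|ε| * L)) ≤ 1 / 2 := by
    have := hε.trans_le (min_le_right _ _)
    rw [lt_div_iff₀ (by positivity)] at this
    have h2 : 32 * Real.pi * (4 / k ^ 2 * (|ε| * L)) = 128 * Real.pi * (|ε| * L) / k ^ 2 := by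
      field_simp
      ring
    rw [h2, div_le_iff₀ (by positivity)]
    have h3 : 0 ≤ |ε| * Real.pi := by positivity
    nlinarith
  set κ : ℂ → ℝ := fun z => k + ε * K z with hκ
  have hκd : ContDiff ℝ 1 κ := contDiff_const.add (contDiff_const.mul hK)
  have hεK : ∀ w, |ε * K w| ≤ |ε| * M := fun w => by
    rw [abs_mul]
    gcongr
    exact hM w
  have hκlow : ∀ w, k / 2 ≤ κ w := fun w => by linarith [neg_le_of_abs_le (hεK w)]
  have hκup : ∀ w, κ w ≤ 3 * k / 2 := fun w => by linarith [le_of_abs_le (hεK w)]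
  have hκpos : ∀ w, 0 < κ w := fun w => (half_pos hk).trans_le (hκlow w)
  set m := 2 / (3 * k) with hm
  have hm0 : 0 < m := by positivity
  have hγlow : ∀ w, m ≤ (κ w)⁻¹ := fun w => by
    rw [hm, show 2 / (3 * k) = (3 * k / 2)⁻¹ by rw [inv_div]]
    exact inv_anti₀ (hκpos w) (hκup w)
  have hγup : ∀ w, (κ w)⁻¹ ≤ 3 * m := fun w => by
    rw [hm, show 3 * (2 / (3 * k)) = (k / 2)⁻¹ by field_simp]
    exact inv_anti₀ (half_pos hk) (hκlow w)
  set ℓ := 4 / k ^ 2 * (|ε| * L) with hℓ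
  have hℓ0 : 0 ≤ ℓ := by positivity
  have hγlip : ∀ a b, |(κ a)⁻¹ - (κ b)⁻¹| ≤ ℓ * ‖a - b‖ := fun a b => by
    refine (abs_inv_sub_inv_le_of_lower hk (hκlow a) (hκlow b)).trans ?_
    rw [hℓ, hκ, add_sub_add_left_eq_sub, ← mul_sub, abs_mul, mul_assoc, mul_assoc]
    gcongr
    exact hKlip a b
  obtain ⟨U, hUw, hUeq, hUlip⟩ := exists_curve_family hm0 hγlow hγup hℓ0 hγlip hε2
  obtain ⟨Q, hQ, hQκ⟩ := exists_contDiff_fderiv_one_eq hκd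
  have hUd : ∀ z α, HasDerivAt (U z) (velocity (fun s => (κ (U z s))⁻¹) α) α := fun z α =>
    (((hUw z).hasDerivAt_centredCurve α).const_add z).congr_of_eventuallyEq
      (Eventually.of_forall (hUeq z))
  have hper : ∀ z, Function.Periodic (U z) (2 * Real.pi) := fun z α => by
    rw [hUeq, hUeq z α, (hUw z).periodic_centredCurve α]
  have hUc : ∀ z, Continuous (U z) := fun z =>
    continuous_iff_continuousAt.2 fun α => (hUd z α).continuousAt
  have hmean : ∀ z, ∫ s in (0 : ℝ)..2 * Real.pi, U z s = (2 * Real.pi) • z := fun z => by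
    rw [intervalIntegral.integral_congr (fun s _ => hUeq z s), intervalIntegral.integral_add (continuous_const.intervalIntegrable _ _)
      ((hUw z).continuous_centredCurve.intervalIntegrable _ _), (hUw z).integral_centredCurve,
      intervalIntegral.integral_const, sub_zero, add_zero]
  have hwlip : ∀ y z s, |(κ (U y s))⁻¹ - (κ (U z s))⁻¹| ≤ ℓ * (2 * ‖y - z‖) := fun y z s =>
    (hγlip _ _).trans (mul_le_mul_of_nonneg_left (hUlip y z s) hℓ0)
  have hclose : ∀ z α, ‖U z α - (z + (1 / k) • cis α)‖ ≤ C₁ * |ε| := fun z α => by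
    have hconst : IsWeight m fun _ => k⁻¹ :=
      { pos := hm0
        cont := continuous_const
        periodic := fun _ => rfl
        lower := fun _ => by
          rw [hm, div_le_iff₀ (by positivity)]
          field_simp
          norm_num
        upper := fun _ => by
          rw [hm]
          field_simp
          norm_num }
    have h := (hUw z).norm_centredCurve_sub_le hconst (δ := 2 / k ^ 2 * (|ε| * M))
      (fun s => abs_inv_sub_inv_le hk (hκlow _) (by rw [hκ, add_sub_cancel_left]; exact hεK _)) α
    rw [centredCurve_const] at h
    rw [hUeq, add_sub_add_left_eq_sub, one_div]
    refine h.trans (le_of_eq ?_)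
    rw [hC₁]
    ring
  refine ⟨U, fun z => -(2 * Real.pi) • (Complex.I * closingConst fun s => (κ (U z s))⁻¹),
    fun z => action Q (U z), ?_, fun z => ?_, fun z hz => ?_, fun z α => ?_, fun z => ?_⟩
  · have hlip : ∀ y z, dist (closingConst fun s => (κ (U y s))⁻¹)
        (closingConst fun s => (κ (U z s))⁻¹) ≤ (4 * ℓ / m) * dist y z := fun y z => by
      rw [dist_eq_norm, dist_eq_norm]
      refine ((hUw y).norm_closingConst_sub_le (hUw z) (hwlip y z)).trans (le_of_eq ?_)
      ring
    have : Continuous fun z => closingConst fun s => (κ (U z s))⁻¹ :=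
      (LipschitzWith.of_dist_le_mul (K := ⟨4 * ℓ / m, by positivity⟩) hlip).continuous
    fun_prop
  -- The curves are `2`-Lipschitz in the centre and their velocities `8 · 2ℓ`-Lipschitz, so `2 +
  -- 16ℓ` bounds both.
  · refine hasFDerivAt_action (C := 2 + 16 * ℓ) hQ hQκ hUd
      (fun z => (hUw z).continuous_velocity) hper hmean (by positivity) (fun y α => ?_)
      (fun y α => ?_) fun α => ?_
    · refine (hUlip y z α).trans (mul_le_mul_of_nonneg_right ?_ (norm_nonneg _))
      linarith
    · refine ((hUw y).norm_velocity_sub_le (hUw z) (hwlip y z) α).trans ?_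
      nlinarith [norm_nonneg (y - z)]
    · rw [velocity, smul_inv_smul₀ (hκpos _).ne']
  · have hc : (closingConst fun s => (κ (U z s))⁻¹) = 0 := by
      have h2 : -(2 * Real.pi) ≠ 0 := neg_ne_zero.2 Real.two_pi_pos.ne'
      simpa [h2] using hz
    refine ⟨hper z, fun θ => hκpos _, fun θ => ?_⟩
    have := hUd z θ
    rwa [velocity, hc, add_zero] at this
  · refine (hclose z α).trans (mul_le_mul_of_nonneg_right ?_ (abs_nonneg _))
    linarith
  · refine (norm_closingConst_sub_melnikovGrad_le hk hK.continuous hM hKlip hL0 hC₁0 hε1 (hUc z)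
      (hclose z) (hUw z)).trans (mul_le_mul_of_nonneg_right ?_ (sq_nonneg _))
    linarith

/-! ### Using the stability of the critical point -/

lemma continuous_melnikovGrad {k : ℝ} {K : ℂ → ℝ} (hK : Continuous K) :
    Continuous (melnikovGrad k K) := by
  have : Continuous fun z => ∫ s in (0 : ℝ)..2 * Real.pi, K (z + (1 / k) • cis s) • cis s :=
    intervalIntegral.continuous_parametric_intervalIntegral_of_continuous'
      (by unfold Function.uncurry; fun_prop) 0 (2 * Real.pi)
  unfold melnikovGrad
  fun_prop

/-- A function whose gradient is uniformly close to that of a function with a stable critical point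
in a bounded set has a critical point in that set. -/
theorem HasStableCriticalPoint.exists_zero {X : ℂ → ℝ} {A : Set ℂ} (h : HasStableCriticalPoint X A)
    (hA : Bornology.IsBounded A) {ξ : ℂ → ℂ} (hX : ∀ z, HasFDerivAt X (innerSL ℝ (ξ z)) z) :
    ∃ η > 0, ∀ (G : ℂ → ℝ) (w : ℂ → ℂ), Continuous w →
      (∀ z, HasFDerivAt G (innerSL ℝ (w z)) z) → (∀ z, ‖w z - ξ z‖ ≤ η) → ∃ z ∈ A, w z = 0 := by
  obtain ⟨r, hr, h⟩ := h
  obtain ⟨R, hR0, hR⟩ := hA.exists_pos_norm_le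
  refine ⟨r / (4 * (R + 1)), by positivity, fun G w hw hG hclose => ?_⟩
  set η := r / (4 * (R + 1)) with hη
  have hη0 : 0 < η := by positivity
  have hη1 : η * (R + 1) = r / 4 := by
    rw [hη]
    field_simp
  -- Only gradients are compared, so the additive constant is normalized to agree with `X` at `0`.
  -- The mean value inequality then controls the values on the bounded set `A`, and each half of the
  -- `C¹` norm is at most `r / 4`.
  have hG' : ∀ z, HasFDerivAt (fun z => X 0 + (G z - G 0)) (innerSL ℝ (w z)) z := fun z =>
    ((hG z).sub_const _).const_add _
  have hdiff : ∀ z, HasFDerivAt (fun z => X 0 + (G z - G 0) - X z)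
      (innerSL ℝ (w z) - innerSL ℝ (ξ z)) z := fun z => (hG' z).sub (hX z)
  have hnorm : ∀ z, ‖innerSL ℝ (w z) - innerSL ℝ (ξ z)‖ ≤ η := fun z => by
    rw [← map_sub, innerSL_apply_norm]
    exact hclose z
  have hval : ∀ z, ‖X 0 + (G z - G 0) - X z‖ ≤ η * ‖z‖ := fun z => by
    have := convex_univ.norm_image_sub_le_of_norm_hasFDerivWithin_le
      (fun x _ => (hdiff x).hasFDerivWithinAt) (fun x _ => hnorm x) (Set.mem_univ 0)
      (Set.mem_univ z)
    simpa using this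
  have hle : ∀ {E : Type} [NormedAddCommGroup E] (x : E), ‖x‖ ≤ r / 4 →
      ‖x‖ₑ ≤ ENNReal.ofReal (r / 4) := fun x hx => by
    rw [← ofReal_norm]
    exact ENNReal.ofReal_le_ofReal hx
  obtain ⟨z, hzA, hz⟩ := h (fun z => X 0 + (G z - G 0))
    ⟨(continuous_iff_continuousAt.2 fun z => (hG' z).continuousAt).continuousOn,
      fun z => innerSL ℝ (w z), ((innerSL ℝ).continuous.comp hw).continuousOn,
      fun z _ => hG' z⟩ (by
    have h1 : c1Norm A (fun z => X 0 + (G z - G 0) - X z) ≤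
        ENNReal.ofReal (r / 4) + ENNReal.ofReal (r / 4) := by
      refine add_le_add (iSup₂_le fun z hz => hle _ ?_) (iSup₂_le fun z hz => hle _ ?_)
      · refine (hval z).trans ?_
        rw [← hη1]
        have := hR z hz
        gcongr
        linarith
      · rw [(hdiff z).fderiv]
        refine (hnorm z).trans ?_
        nlinarith
    refine h1.trans_lt ?_
    rw [← ENNReal.ofReal_add (by positivity) (by positivity)]
    exact (ENNReal.ofReal_lt_ofReal_iff hr).2 (by linarith))
  refine ⟨z, hzA, ?_⟩
  have h0 : innerSL ℝ (w z) = 0 := (hG' z).unique hz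
  rwa [← norm_eq_zero, innerSL_apply_norm, norm_eq_zero] at h0

/-- The `C¹` norm sees the two functions only through their germs at points of `A`. -/
lemma HasStableCriticalPoint.congr {X Y : ℂ → ℝ} {A : Set ℂ} (h : HasStableCriticalPoint X A)
    (hXY : ∀ z ∈ A, X =ᶠ[𝓝 z] Y) : HasStableCriticalPoint Y A := by
  obtain ⟨r, hr, h⟩ := h
  refine ⟨r, hr, fun G hG hn => h G hG ?_⟩
  have hEq : ∀ z ∈ A, (fun z => G z - X z) =ᶠ[𝓝 z] fun z => G z - Y z := fun z hz => by
    filter_upwards [hXY z hz] with y hy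
    rw [hy]
  have : c1Norm A (fun z => G z - X z) = c1Norm A (fun z => G z - Y z) := by
    unfold c1Norm
    congr 1
    · exact iSup_congr fun z => iSup_congr fun hz => congrArg _ (hEq z hz).eq_of_nhds
    · exact iSup_congr fun z => iSup_congr fun hz => by rw [(hEq z hz).fderiv_eq]
  rwa [this]

/-- Existence of angle curves near circles with nearly critical centres, for a curvature
perturbation with bounded values and bounded differential. -/
theorem exists_isAngleCurve_of_stable {k M L : ℝ} (hk : 0 < k) {K : ℂ → ℝ} (hK : ContDiff ℝ 1 K)
    (hM : ∀ z, |K z| ≤ M) (hL : ∀ z, ‖fderiv ℝ K z‖ ≤ L) {A : Set ℂ} (hA : Bornology.IsBounded A)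
    (hstable : HasStableCriticalPoint (melnikov k K) A) :
    ∃ ε₀ > 0, ∃ C ≥ 0, ∃ (z : ℝ → ℂ) (u : ℝ → ℝ → ℂ), (∀ ε, z ε ∈ A) ∧ ∀ ε, |ε| < ε₀ →
      IsAngleCurve (fun z => k + ε * K z) (u ε) ∧
      (∀ α, ‖u ε α - (z ε + (1 / k) • cis α)‖ ≤ C * |ε|) ∧
      ‖melnikovGrad k K (z ε)‖ ≤ C * |ε| := by
  have hX : ∀ z, HasFDerivAt (melnikov k K) (innerSL ℝ (melnikovGrad k K z)) z :=
    hasFDerivAt_melnikov hk hK hL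
  obtain ⟨η, hη, hzero⟩ := hstable.exists_zero hA hX
  -- Stability applied to the Melnikov function itself. This point is the centre for `ε = 0`, where
  -- division by `ε` is impossible, and a dummy value for `ε` out of range.
  obtain ⟨z₀, hz₀, hcrit⟩ := hzero _ _ (continuous_melnikovGrad hK.continuous) hX
    fun z => by simpa using hη.le
  obtain ⟨ε₁, hε₁, C, hC, hred⟩ := exists_reduction hk hK hM hL
  have key : ∀ ε : ℝ, ∃ (z : ℂ) (u : ℝ → ℂ), z ∈ A ∧ (|ε| < min ε₁ (η / (C + 1)) →
      IsAngleCurve (fun z => k + ε * K z) u ∧ (∀ α, ‖u α - (z + (1 / k) • cis α)‖ ≤ C * |ε|) ∧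
      ‖melnikovGrad k K z‖ ≤ C * |ε|) := fun ε => by
    by_cases hε : |ε| < min ε₁ (η / (C + 1))
    swap
    · exact ⟨z₀, 0, hz₀, fun h => absurd h hε⟩
    rcases eq_or_ne ε 0 with rfl | hε0
    · refine ⟨z₀, fun α => z₀ + (1 / k) • cis α, hz₀, fun _ => ⟨?_, by simp, by simp [hcrit]⟩⟩
      exact (isAngleCurve_refCircle hk z₀).congr fun θ => by simp
    · obtain ⟨U, v, a, hv, ha, hU, hclose, hgrad⟩ := hred ε (hε.trans_le (min_le_left _ _))
      have hεη : C * |ε| ≤ η := by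
        have := hε.trans_le (min_le_right _ _)
        rw [lt_div_iff₀ (by positivity)] at this
        nlinarith [abs_nonneg ε]
      have hvg : ∀ z, ‖ε⁻¹ • v z - melnikovGrad k K z‖ ≤ C * |ε| := fun z => by
        have h1 : ε⁻¹ • v z - melnikovGrad k K z = ε⁻¹ • (v z - ε • melnikovGrad k K z) := by
          rw [smul_sub, inv_smul_smul₀ hε0]
        have h2 := abs_pos.2 hε0
        rw [h1, norm_smul, norm_inv, Real.norm_eq_abs, inv_mul_le_iff₀ h2]
        refine (hgrad z).trans (le_of_eq ?_)
        rw [← sq_abs]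
        ring
      obtain ⟨z, hzA, hz⟩ := hzero (fun z => ε⁻¹ • a z) (fun z => ε⁻¹ • v z) (by fun_prop)
        (fun z => by
          rw [map_smul]
          exact (ha z).const_smul ε⁻¹) fun z => (hvg z).trans hεη
      refine ⟨z, U z, hzA, fun _ => ⟨hU z ?_, hclose z, ?_⟩⟩
      · simpa [hε0] using hz
      · simpa only [hz, zero_sub, norm_neg] using hvg z
  choose z u hzA hu using key
  exact ⟨_, by positivity, C, hC, z, u, hzA, hu⟩

/-! ### Cutoff of the curvature perturbation -/

/-- A `C¹` function agrees on any ball with a `C¹` function with bounded values and differential. -/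
lemma exists_bounded_eqOn_closedBall {K : ℂ → ℝ} (hK : ContDiff ℝ 1 K) {ρ : ℝ} (hρ : 0 < ρ) :
    ∃ (K' : ℂ → ℝ) (M L : ℝ), ContDiff ℝ 1 K' ∧ (∀ z, |K' z| ≤ M) ∧ (∀ z, ‖fderiv ℝ K' z‖ ≤ L) ∧
      ∀ z, ‖z‖ ≤ ρ → K' z = K z := by
  let f : ContDiffBump (0 : ℂ) := ⟨ρ, ρ + 1, hρ, by linarith⟩
  have hK' : ContDiff ℝ 1 fun z => f z * K z := f.contDiff.mul hK
  have hsupp : HasCompactSupport fun z => f z * K z := f.hasCompactSupport.mul_right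
  obtain ⟨M, hM⟩ := hsupp.exists_bound_of_continuous hK'.continuous
  obtain ⟨L, hL⟩ := (hsupp.fderiv (𝕜 := ℝ)).exists_bound_of_continuous
    (hK'.continuous_fderiv one_ne_zero)
  refine ⟨_, M, L, hK', hM, hL, fun z hz => ?_⟩
  rw [f.one_of_mem_closedBall (by simpa using hz), one_mul]

lemma melnikov_congr {k ρ : ℝ} {K K' : ℂ → ℝ} (h : ∀ z, ‖z‖ ≤ ρ → K' z = K z) {z : ℂ}
    (hz : ‖z‖ + 1 / k ≤ ρ) : melnikov k K' z = melnikov k K z := by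
  refine setIntegral_congr_fun measurableSet_ball fun q hq => h q ?_
  rw [Metric.mem_ball, dist_eq_norm] at hq
  have := norm_add_le (q - z) z
  rw [sub_add_cancel] at this
  linarith

end PlaneLoops

end

/-! ### The main theorem -/

theorem theoremT (k : ℝ) (hk : 0 < k) (K : ℂ → ℝ) (hK : ContDiff ℝ 1 K)
    (A : Set ℂ) (hA : IsOpen A) (hAc : IsCompact (closure A))
    (hstable : PlaneLoops.HasStableCriticalPoint (PlaneLoops.melnikov k K) A) :
    ∃ ε₀ : ℝ, 0 < ε₀ ∧ ∃ u : ℝ → Circle → ℂ,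
      (∀ ε : ℝ, |ε| < ε₀ →
        PlaneLoops.IsEmbeddedLoopOfCurvature (fun z => k + ε * K z) (u ε)) ∧
      ∀ e : ℕ → ℝ, Tendsto e atTop (𝓝 0) →
        ∃ φ : ℕ → ℕ, StrictMono φ ∧ ∃ z₀ ∈ closure A,
          PlaneLoops.IsCriticalPoint (PlaneLoops.melnikov k K) z₀ ∧
          PlaneLoops.TendstoC2 (fun j => u (e (φ j))) (PlaneLoops.refCircle k z₀) := by
  open PlaneLoops in
  obtain ⟨R, hR0, hR⟩ := hAc.isBounded.exists_pos_norm_le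
  have hk' : 0 < 1 / k := by positivity
  -- The radius covers the disks and circles of radius `1/k` centred in `closure A`. The extra `1`
  -- leaves room for a neighbourhood of each centre, where the two Melnikov functions must agree,
  -- and for the distance `C |ε| ≤ 1` from loop to circle.
  obtain ⟨K', M, L, hK', hM, hL, hEq⟩ :=
    exists_bounded_eqOn_closedBall hK (ρ := R + 1 / k + 1) (by positivity)
  have hmel : ∀ z ∈ closure A, melnikov k K =ᶠ[𝓝 z] melnikov k K' := fun z hz => by
    have hmem : Metric.ball (0 : ℂ) (R + 1) ∈ 𝓝 z :=
      Metric.isOpen_ball.mem_nhds (by simpa using (hR z hz).trans_lt (lt_add_one R))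
    filter_upwards [hmem] with y hy
    rw [mem_ball_zero_iff] at hy
    exact (melnikov_congr hEq (by linarith)).symm
  obtain ⟨ε₀, hε₀, C, hC, z, u, hzA, hu⟩ := exists_isAngleCurve_of_stable hk hK' hM hL
    (hAc.isBounded.subset subset_closure) (hstable.congr fun z hz => hmel z (subset_closure hz))
  refine ⟨min ε₀ (1 / (C + 1)), by positivity, fun ε => ofAngular (u ε), fun ε hε => ?_,
    fun e he => ?_⟩
  · obtain ⟨h1, h2, -⟩ := hu ε (hε.trans_le (min_le_left _ _))
    have hCε : C * |ε| ≤ 1 := by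
      have := hε.trans_le (min_le_right _ _)
      rw [lt_div_iff₀ (by positivity)] at this
      nlinarith [abs_nonneg ε]
    refine (h1.congr fun θ => ?_).isEmbeddedLoop (contDiff_const.add (contDiff_const.mul hK))
    rw [hEq]
    have e1 : u ε θ = (u ε θ - (z ε + (1 / k) • cis θ)) + (z ε + (1 / k) • cis θ) := by ring
    have e2 : ‖(1 / k) • cis θ‖ = 1 / k := by
      rw [norm_smul, norm_cis, mul_one, Real.norm_eq_abs, abs_of_pos hk']
    rw [e1]
    refine (norm_add_le _ _).trans ?_
    linarith [h2 θ, norm_add_le (z ε) ((1 / k) • cis θ), hR _ (subset_closure (hzA ε))]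
  · obtain ⟨z₀, hz₀, φ, hφ, hlim⟩ := hAc.tendsto_subseq fun n => subset_closure (hzA (e n))
    have heφ : Tendsto (fun j => e (φ j)) atTop (𝓝 0) := he.comp hφ.tendsto_atTop
    have hev : ∀ᶠ j in atTop, |e (φ j)| < ε₀ := by
      have h := heφ.abs
      rw [abs_zero] at h
      exact h.eventually (gt_mem_nhds hε₀)
    refine ⟨φ, hφ, z₀, hz₀, ?_, tendstoC2_of_isAngleCurve hk hK' hM hL heφ hlim
      (hev.mono fun j hj => ⟨(hu _ hj).1, (hu _ hj).2.1⟩)⟩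
    -- The gradient at the centres tends both to its value at `z₀`, by continuity, and to `0`, by
    -- the bound `C |ε|`.
    have h1 : Tendsto (fun j => melnikovGrad k K' (z (e (φ j)))) atTop
        (𝓝 (melnikovGrad k K' z₀)) :=
      ((continuous_melnikovGrad hK'.continuous).tendsto z₀).comp hlim
    have h2 : Tendsto (fun j => melnikovGrad k K' (z (e (φ j)))) atTop (𝓝 0) := by
      refine squeeze_zero_norm' (hev.mono fun j hj => (hu _ hj).2.2) ?_
      simpa using heφ.abs.const_mul C
    have h3 := hasFDerivAt_melnikov hk hK' hL z₀
    rw [tendsto_nhds_unique h1 h2, map_zero] at h3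
    exact h3.congr_of_eventuallyEq (hmel z₀ hz₀)
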